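/- Let $d\ge 1$, let $\Omega\subset\mathbb R^d$ be closed and convex, let $\rho>0$, and let $\bar\mu$ be a probability measure on $\Omega$ with Lebesgue density $x\mapsto A\,[(\rho^2-|x|^2)\vee 0]$ on $\mathbb R^d$. Let $a,b\in\Omega$, and let $R:[0,1]\to[0,\infty)$ and $\bar x:[0,1]\to\mathbb R^d$ be continuous on $[0,1]$ and $C^2$ on $(0,1)$, with $R>0$ on $(0,1)$, $\bar x(0)=a$, $\bar x(1)=b$. Put $\mu_t=(x\mapsto R(t)x+\bar x(t))_\sharp\bar\mu$ and assume that every $\mu_t$, $t\in[0,1]$, is concentrated on $\Omega$. A velocity field of $\mu$ is a field $v$ with $v_t\in L^2(\mu_t)$ for a.e. $t$ and $\int\phi\,d\mu_{t_2}-\int\phi\,d\mu_{t_1}=\int_{t_1}^{t_2}\int\nabla\phi\cdot v_s\,d\mu_s\,ds$ for all $0\le t_1<t_2\le1$ and all compactly supported $C^1$ functions $\phi$ on $\mathbb R^d$ (the inner integral being integrable in $s$); a tangent field is a velocity field that for a.e. $t$ has minimal $L^2(\mu_t)$ norm among all velocity fields. Put $F(t)=\int_\Omega u(t,x)^2\,dx$,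 where $u(t,\cdot)$ is the density of $\mu_t$, $V(t)=\int|v_t|^2\,d\mu_t$, where $v$ is the tangent field, and $K=FV^{-1/2}$. When $K$ is a constant in $(0,\infty)$, we say that $\mu$ solves the system if, for suitable representatives ($u\ge 0$ continuous on $(0,1)\times\Omega$; $u$ and $v$ of class $C^1$ on $\{u>0\}=\{(t,x): 0<t<1,\ x\in\operatorname{int}\Omega,\ u(t,x)>0\}$; and $F V^{-1/2}=K$ at every $t\in(0,1)$), its density $u$ and its tangent field $v$ satisfy $$\begin{cases}-2V(t)^{1/2}\nabla u+K\left(v\cdot\nabla v+\partial_t v\right)=0&\text{in }\{u>0\},\\ \partial_t u+\nabla\cdot(vu)=0&\text{in }\Omega\text{, in the sense of distributions as above},\\ u\,v\cdot n=0&\text{on }\partial\Omega\text{ for every outward normal }n,\\ u(t,\cdot)\mathcal L^d\rightharpoonup\mu_0\ (t\downarrow0),\quad u(t,\cdot)\mathcal L^d\rightharpoonup\mu_1\ (t\uparrow1).\end{cases}$$ Then: (1) If $\mu$ is parametrized so that $K$ is (for a.e. $t$) a constant in $(0,\infty)$, then $\mu$ solves the system if and only if $\bar x(t)=(1-t)a+tb$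 for all $t\in[0,1]$ and $R$ is strictly concave on $[0,1]$. (2) $K$ is a constant in $(0,\infty)$ and $\mu$ solves the system if and only if $\bar x''=0$ on $(0,1)$, the function $R^{2d}\left(d\rho^2(R')^2+(d+4)|\bar x'|^2\right)$ is constant on $(0,1)$, and $R$ is strictly concave on $[0,1]$. -/

import Mathlib

open MeasureTheory Set Filter Topology
open scoped ENNReal

noncomputable section

namespace WassersteinConformal

/-- The functional `L_q` on measures: the integral of the `q`-th power of the Lebesgue density,
and `+∞` on measures that are not absolutely continuous. -/
def densityFunctional {d : ℕ} (q : ℝ) (ν : Measure (EuclideanSpace ℝ (Fin d))) : ℝ≥0∞ :=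
  open Classical in
  if ν ≪ volume then ∫⁻ x, (ν.rnDeriv volume x) ^ q else ⊤

/-- The continuity equation `∂ₜ μ + ∇ · (v μ) = 0` in the sense of distributions, on the time
interval `I`. The test functions are `C¹` with compact support in the whole space; for curves of
measures on a closed set `Ω` only their restrictions to `Ω` matter, so they represent `C¹_c(Ω)`
(they need not vanish on the boundary of `Ω`). -/
def ContinuityEquation {d : ℕ} (I : Set ℝ) (μ : ℝ → Measure (EuclideanSpace ℝ (Fin d)))
    (v : ℝ → EuclideanSpace ℝ (Fin d) → EuclideanSpace ℝ (Fin d)) : Prop :=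
  ∀ φ : EuclideanSpace ℝ (Fin d) → ℝ, ContDiff ℝ 1 φ → HasCompactSupport φ →
    ∀ t₁ ∈ I, ∀ t₂ ∈ I, t₁ < t₂ →
      IntervalIntegrable (fun s => ∫ x, inner ℝ (gradient φ x) (v s x) ∂(μ s)) volume t₁ t₂ ∧
      (∫ x, φ x ∂(μ t₂)) - (∫ x, φ x ∂(μ t₁))
        = ∫ s in t₁..t₂, ∫ x, inner ℝ (gradient φ x) (v s x) ∂(μ s)

/-- `v` is a velocity field of the curve `μ` on `[0,1]`. -/
def IsVelocityField {d : ℕ} (μ : ℝ → Measure (EuclideanSpace ℝ (Fin d)))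
    (v : ℝ → EuclideanSpace ℝ (Fin d) → EuclideanSpace ℝ (Fin d)) : Prop :=
  (∀ᵐ t ∂(volume.restrict (Icc (0 : ℝ) 1)), MemLp (v t) 2 (μ t)) ∧
    ContinuityEquation (Icc (0 : ℝ) 1) μ v

/-- `v` is a tangent field of the curve `μ`: a velocity field which has, for almost every time,
the minimal `L²(μ_t)` norm among all velocity fields. -/
def IsTangentField {d : ℕ} (μ : ℝ → Measure (EuclideanSpace ℝ (Fin d)))
    (v : ℝ → EuclideanSpace ℝ (Fin d) → EuclideanSpace ℝ (Fin d)) : Prop :=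
  IsVelocityField μ v ∧
    ∀ w : ℝ → EuclideanSpace ℝ (Fin d) → EuclideanSpace ℝ (Fin d), IsVelocityField μ w →
      ∀ᵐ t ∂(volume.restrict (Icc (0 : ℝ) 1)),
        eLpNorm (v t) 2 (μ t) ≤ eLpNorm (w t) 2 (μ t)

/-- `V(t) = ∫ |v_t|² dμ_t`. -/
def kineticV {d : ℕ} (μ : ℝ → Measure (EuclideanSpace ℝ (Fin d)))
    (v : ℝ → EuclideanSpace ℝ (Fin d) → EuclideanSpace ℝ (Fin d)) (t : ℝ) : ℝ≥0∞ :=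
  ∫⁻ x, ‖v t x‖ₑ ^ 2 ∂(μ t)

/-- `K(t) = F(t) V(t)^{-1/2}`, where `F(t) = L₂(μ_t)`; it is infinite where `V` vanishes and
`F` does not. -/
def coefficientK {d : ℕ} (μ : ℝ → Measure (EuclideanSpace ℝ (Fin d)))
    (v : ℝ → EuclideanSpace ℝ (Fin d) → EuclideanSpace ℝ (Fin d)) (t : ℝ) : ℝ≥0∞ :=
  densityFunctional 2 (μ t) * kineticV μ v t ^ (-(1 / 2) : ℝ)

/-- The curve `μ` is parametrised so that `K = F V^{-1/2}`, computed with the tangent field, is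
the (finite, positive) constant `K`. Tangent fields being determined for almost every time only,
so is the function `t ↦ V(t)`. -/
def HasConstantK {d : ℕ} (μ : ℝ → Measure (EuclideanSpace ℝ (Fin d))) (K : ℝ) : Prop :=
  0 < K ∧ ∃ v : ℝ → EuclideanSpace ℝ (Fin d) → EuclideanSpace ℝ (Fin d),
    IsTangentField μ v ∧
      ∀ᵐ t ∂(volume.restrict (Icc (0 : ℝ) 1)), coefficientK μ v t = ENNReal.ofReal K

/-- The measure on `Ω` with Lebesgue density `f`. -/
def densityMeasure {d : ℕ} (Ω : Set (EuclideanSpace ℝ (Fin d)))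
    (f : EuclideanSpace ℝ (Fin d) → ℝ) : Measure (EuclideanSpace ℝ (Fin d)) :=
  (volume.restrict Ω).withDensity fun x => ENNReal.ofReal (f x)

/-- The (open) region `{u > 0}` of space-time. -/
def positivitySet {d : ℕ} (Ω : Set (EuclideanSpace ℝ (Fin d)))
    (u : ℝ → EuclideanSpace ℝ (Fin d) → ℝ) : Set (ℝ × EuclideanSpace ℝ (Fin d)) :=
  {p | p.1 ∈ Ioo (0 : ℝ) 1 ∧ p.2 ∈ interior Ω ∧ 0 < u p.1 p.2}

/-- The pair `(u, v)` solves the system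
* `-2 V^{1/2} ∇u + K (v · ∇v + ∂ₜ v) = 0` in `{u > 0}`, classically,
* `∂ₜ u + ∇ · (v u) = 0` in `Ω`, in the sense of distributions,
* `u v · n = 0` on the boundary of `Ω`, for every outward normal `n`,
* `u_t 𝓛ᵈ → μ₀` as `t ↓ 0` and `u_t 𝓛ᵈ → μ₁` as `t ↑ 1`, weakly,

with the constant `K = F V^{-1/2}`. -/
structure SolvesSystem {d : ℕ} (Ω : Set (EuclideanSpace ℝ (Fin d)))
    (μ₀ μ₁ : Measure (EuclideanSpace ℝ (Fin d))) (K : ℝ)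
    (u : ℝ → EuclideanSpace ℝ (Fin d) → ℝ)
    (v : ℝ → EuclideanSpace ℝ (Fin d) → EuclideanSpace ℝ (Fin d)) : Prop where
  nonneg : ∀ t ∈ Ioo (0 : ℝ) 1, ∀ x ∈ Ω, 0 ≤ u t x
  continuousOn_density :
    ContinuousOn (fun p : ℝ × EuclideanSpace ℝ (Fin d) => u p.1 p.2) (Ioo (0 : ℝ) 1 ×ˢ Ω)
  contDiffOn_density :
    ContDiffOn ℝ 1 (fun p : ℝ × EuclideanSpace ℝ (Fin d) => u p.1 p.2) (positivitySet Ω u)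
  contDiffOn_velocity :
    ContDiffOn ℝ 1 (fun p : ℝ × EuclideanSpace ℝ (Fin d) => v p.1 p.2) (positivitySet Ω u)
  constantK : ∀ t ∈ Ioo (0 : ℝ) 1,
    coefficientK (fun s => densityMeasure Ω (u s)) v t = ENNReal.ofReal K
  momentum : ∀ t x, (t, x) ∈ positivitySet Ω u →
    -(2 * Real.sqrt (kineticV (fun s => densityMeasure Ω (u s)) v t).toReal) • gradient (u t) x
      + K • (fderiv ℝ (v t) x (v t x) + deriv (fun s => v s x) t) = 0
  continuity : ContinuityEquation (Ioo (0 : ℝ) 1) (fun s => densityMeasure Ω (u s)) v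
  no_flux : ∀ t ∈ Ioo (0 : ℝ) 1, ∀ x ∈ frontier Ω, ∀ n : EuclideanSpace ℝ (Fin d),
    (∀ y ∈ Ω, inner ℝ (y - x) n ≤ 0) → u t x * inner ℝ (v t x) n = 0
  initial : ∀ f : BoundedContinuousFunction (EuclideanSpace ℝ (Fin d)) ℝ,
    Tendsto (fun t => ∫ x, f x ∂(densityMeasure Ω (u t))) (𝓝[>] 0) (𝓝 (∫ x, f x ∂μ₀))
  final : ∀ f : BoundedContinuousFunction (EuclideanSpace ℝ (Fin d)) ℝ,
    Tendsto (fun t => ∫ x, f x ∂(densityMeasure Ω (u t))) (𝓝[<] 1) (𝓝 (∫ x, f x ∂μ₁))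

/-- The curve `μ` of measures on `Ω` solves the system together with its own tangent field: its
density `u` and its tangent field `v` (for suitable representatives of the two almost-everywhere
defined functions) solve it, with end points `μ 0` and `μ 1`. -/
def CurveSolvesSystem {d : ℕ} (Ω : Set (EuclideanSpace ℝ (Fin d)))
    (μ : ℝ → Measure (EuclideanSpace ℝ (Fin d))) (K : ℝ) : Prop :=
  ∃ (u : ℝ → EuclideanSpace ℝ (Fin d) → ℝ)
    (v : ℝ → EuclideanSpace ℝ (Fin d) → EuclideanSpace ℝ (Fin d)),
    (∀ t ∈ Ioo (0 : ℝ) 1, μ t = densityMeasure Ω (u t)) ∧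
      IsTangentField μ v ∧ SolvesSystem Ω (μ 0) (μ 1) K u v

/-- The curve `μ_t = (x ↦ R(t) x + x̄(t))_♯ μ̄`. -/
def movingHomothety {d : ℕ} (μbar : Measure (EuclideanSpace ℝ (Fin d))) (R : ℝ → ℝ)
    (xbar : ℝ → EuclideanSpace ℝ (Fin d)) (t : ℝ) : Measure (EuclideanSpace ℝ (Fin d)) :=
  μbar.map fun x => R t • x + xbar t

end WassersteinConformal

end

noncomputable section

namespace WassersteinConformal

/-! The flow x ↦ R x + x̄ has Eulerian velocity v = (R'/R)(y - x̄) + x̄', at each time the gradient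
of a quadratic polynomial. For a.e. t any velocity field w pairs with ∇φ in L²(μ_t) exactly as v
does, and because the measures have uniformly bounded support φ may be a coordinate or |y|². Hence w
- v is orthogonal to v, and Pythagoras makes v tangent and every tangent field equal to v
(`ae_integral_inner_sub_eq_zero`, `ae_eq_of_isTangentField`). So F and V are explicit: F = R⁻ᵈ F₀
with F₀ = 4Aρ²/(d+4), V = m R'² + |x̄'|² with m = dρ²/(d+4), and constancy of K means R²ᵈ V = F₀²/K²
(`energy_eq_of_hasConstantK`).

The region {u > 0} is the moving ball. There u is quadratic and v affine in y, so the left side of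
the momentum equation is affine in y - x̄. It vanishes on the ball iff x̄'' = 0 and K R'' + 4A√V /
Rᵈ⁺¹ = 0 (`momentum_iff`). Since V > 0, the second equation forces R'' < 0, hence strict concavity.

Conversely, if x̄'' = 0, differentiating R²ᵈ V = const gives R' (d V + m R R'') = 0. Strict
concavity lets R' vanish at most once, so the bracket vanishes everywhere by continuity; combined
with F = K√V it is the required equation for R (`deriv_deriv_scale_of_strictConcaveOn`). The
remaining conditions of the system hold for every such curve: u vanishes on ∂Ω, and μ is weakly
continuous up to the end points.

In the converse of (2) no velocity field is given. Concavity makes R' integrable up to the end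
points, which makes v a velocity field; it also makes the conserved constant positive, which yields
K (`exists_hasConstantK`). -/

/-- The parabolic density `A [(ρ² - |x|²) ∨ 0]`. -/
def parabolicDensity {d : ℕ} (A ρ : ℝ) (x : EuclideanSpace ℝ (Fin d)) : ℝ :=
  A * max (ρ ^ 2 - ‖x‖ ^ 2) 0

/-- `ν` is a probability measure with parabolic density. -/
structure IsParabolicProfile {d : ℕ} (A ρ : ℝ) (ν : Measure (EuclideanSpace ℝ (Fin d))) :
    Prop where
  dim_pos : 0 < d
  radius_pos : 0 < ρ
  isProbabilityMeasure : IsProbabilityMeasure ν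
  eq_withDensity : ν = volume.withDensity fun x => ENNReal.ofReal (parabolicDensity A ρ x)

/-! ### Moments of the parabolic profile. -/

theorem integral_Ioi_pow_mul_max (ρ : ℝ) (hρ : 0 < ρ) (k : ℕ) :
    ∫ y in Ioi (0 : ℝ), y ^ k * max (ρ ^ 2 - y ^ 2) 0
      = 2 * ρ ^ (k + 3) / ((k + 1) * (k + 3)) := by
  have h1 : ∫ y in Ioi (0 : ℝ), y ^ k * max (ρ ^ 2 - y ^ 2) 0
      = ∫ y in Ioc (0 : ℝ) ρ, y ^ k * max (ρ ^ 2 - y ^ 2) 0 := by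
    refine setIntegral_eq_of_subset_of_forall_sdiff_eq_zero measurableSet_Ioi
      Ioc_subset_Ioi_self ?_
    rintro y ⟨hy, hy'⟩
    have hy0 : 0 < y := hy
    have : ρ < y := by
      by_contra! h
      exact hy' ⟨hy0, h⟩
    rw [max_eq_right (by nlinarith), mul_zero]
  have h2 : ∫ y in (0 : ℝ)..ρ, y ^ k * max (ρ ^ 2 - y ^ 2) 0
      = ∫ y in (0 : ℝ)..ρ, (ρ ^ 2 * y ^ k - y ^ (k + 2)) := by
    refine intervalIntegral.integral_congr fun y hy => ?_
    rw [uIcc_of_le hρ.le] at hy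
    have : y ^ 2 ≤ ρ ^ 2 := pow_le_pow_left₀ hy.1 hy.2 2
    rw [max_eq_left (by linarith)]
    ring
  rw [h1, ← intervalIntegral.integral_of_le hρ.le, h2, intervalIntegral.integral_sub
    (Continuous.intervalIntegrable (by fun_prop) _ _)
    (Continuous.intervalIntegrable (by fun_prop) _ _), intervalIntegral.integral_const_mul,
    integral_pow, integral_pow]
  have hk : (k : ℝ) + 1 ≠ 0 := by positivity
  have hk' : (k : ℝ) + 3 ≠ 0 := by positivity
  have hk'' : (k : ℝ) + 2 + 1 ≠ 0 := by positivity
  push_cast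
  field_simp
  ring

theorem continuous_parabolicDensity {d : ℕ} (A ρ : ℝ) :
    Continuous (parabolicDensity (d := d) A ρ) := by
  unfold parabolicDensity
  fun_prop

namespace IsParabolicProfile

variable {d : ℕ} {A ρ : ℝ} {ν : Measure (EuclideanSpace ℝ (Fin d))}

/-- For A ≤ 0 the truncated density is zero, contradicting total mass one. -/
theorem amplitude_pos (h : IsParabolicProfile A ρ ν) : 0 < A := by
  by_contra! hA
  have h0 : ν = 0 := by
    rw [h.eq_withDensity]
    have : (fun x : EuclideanSpace ℝ (Fin d) => ENNReal.ofReal (parabolicDensity A ρ x))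
        = fun _ => 0 := by
      funext x
      exact ENNReal.ofReal_of_nonpos (mul_nonpos_of_nonpos_of_nonneg hA (le_max_right _ _))
    rw [this]
    exact withDensity_zero
  have := h.isProbabilityMeasure.measure_univ
  rw [h0] at this
  simp at this

theorem density_nonneg (h : IsParabolicProfile A ρ ν) (x : EuclideanSpace ℝ (Fin d)) :
    0 ≤ parabolicDensity A ρ x :=
  mul_nonneg h.amplitude_pos.le (le_max_right _ _)

theorem density_pos_iff (h : IsParabolicProfile A ρ ν) {x : EuclideanSpace ℝ (Fin d)} :
    0 < parabolicDensity A ρ x ↔ ‖x‖ < ρ := by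
  unfold parabolicDensity
  rw [mul_pos_iff_of_pos_left h.amplitude_pos, lt_max_iff]
  simp only [lt_irrefl, or_false, sub_pos]
  rw [sq_lt_sq₀ (norm_nonneg _) h.radius_pos.le]

theorem ae_norm_lt (h : IsParabolicProfile A ρ ν) : ∀ᵐ x ∂ν, ‖x‖ < ρ := by
  rw [h.eq_withDensity, ae_withDensity_iff
    (continuous_parabolicDensity A ρ).measurable.ennreal_ofReal]
  refine .of_forall fun x hx => ?_
  rw [← h.density_pos_iff]
  exact ENNReal.ofReal_pos.1 (pos_iff_ne_zero.2 hx)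

theorem memLp_of_continuous (h : IsParabolicProfile A ρ ν) {F : Type*}
    [NormedAddCommGroup F] {f : EuclideanSpace ℝ (Fin d) → F} (hf : Continuous f) (p : ℝ≥0∞) :
    MemLp f p ν := by
  have := h.isProbabilityMeasure
  obtain ⟨C, hC⟩ := (isCompact_closedBall (0 : EuclideanSpace ℝ (Fin d)) ρ)
    |>.exists_bound_of_continuousOn hf.continuousOn
  refine MemLp.of_bound hf.aestronglyMeasurable C ?_
  filter_upwards [h.ae_norm_lt] with x hx
  exact hC x (by simpa using hx.le)

theorem integrable_of_continuous (h : IsParabolicProfile A ρ ν) {F : Type*}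
    [NormedAddCommGroup F] {f : EuclideanSpace ℝ (Fin d) → F}
    (hf : Continuous f) : Integrable f ν :=
  memLp_one_iff_integrable.1 (h.memLp_of_continuous hf 1)

theorem integral_eq (h : IsParabolicProfile A ρ ν) (f : EuclideanSpace ℝ (Fin d) → ℝ) :
    ∫ x, f x ∂ν = ∫ x, parabolicDensity A ρ x * f x := by
  conv_lhs => rw [h.eq_withDensity]
  rw [integral_withDensity_eq_integral_toReal_smul
    (continuous_parabolicDensity A ρ).measurable.ennreal_ofReal (by simp)]
  refine integral_congr_ae (.of_forall fun x => ?_)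
  simp [ENNReal.toReal_ofReal (h.density_nonneg x)]

theorem integral_norm_pow (h : IsParabolicProfile A ρ ν) (k : ℕ) :
    ∫ x, ‖x‖ ^ k ∂ν = d * (volume.real (Metric.ball (0 : EuclideanSpace ℝ (Fin d)) 1) *
      (A * (2 * ρ ^ (d + k + 2) / ((d + k : ℝ) * (d + k + 2))))) := by
  have : Nontrivial (EuclideanSpace ℝ (Fin d)) := by
    have : Nonempty (Fin d) := ⟨⟨0, h.dim_pos⟩⟩
    infer_instance
  rw [h.integral_eq]
  have := integral_fun_norm_addHaar (volume : Measure (EuclideanSpace ℝ (Fin d)))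
    (fun y : ℝ => A * max (ρ ^ 2 - y ^ 2) 0 * y ^ k)
  simp only [parabolicDensity]
  rw [this, finrank_euclideanSpace_fin]
  simp only [nsmul_eq_mul, smul_eq_mul]
  obtain ⟨n, rfl⟩ : ∃ n, d = n + 1 := ⟨d - 1, by have := h.dim_pos; omega⟩
  have h2 := integral_Ioi_pow_mul_max ρ h.radius_pos (n + k)
  have h3 : ∫ y in Ioi (0 : ℝ), y ^ (n + 1 - 1) * (A * max (ρ ^ 2 - y ^ 2) 0 * y ^ k)
      = A * ∫ y in Ioi (0 : ℝ), y ^ (n + k) * max (ρ ^ 2 - y ^ 2) 0 := by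
    rw [← integral_const_mul]
    refine integral_congr_ae (.of_forall fun y => ?_)
    simp only [Nat.add_sub_cancel]
    ring
  rw [h3, h2]
  push_cast
  rw [show n + 1 + k + 2 = n + k + 3 by ring]
  congr 5 <;> ring

/-- The zeroth moment, which equals 1, fixes the product of A and the volume of the unit ball, so
neither has to be computed to get the second moment. -/
theorem integral_norm_sq (h : IsParabolicProfile A ρ ν) :
    ∫ x, ‖x‖ ^ 2 ∂ν = d * ρ ^ 2 / (d + 4) := by
  have h0 := h.integral_norm_pow 0
  have h2 := h.integral_norm_pow 2
  have := h.isProbabilityMeasure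
  simp only [pow_zero, integral_const, probReal_univ, smul_eq_mul, mul_one, Nat.cast_zero,
    add_zero] at h0
  rw [h2]
  have hd : (0 : ℝ) < d := by exact_mod_cast h.dim_pos
  have h1 : volume.real (Metric.ball (0 : EuclideanSpace ℝ (Fin d)) 1) * (A * 2 * ρ ^ (d + 2))
      = d + 2 := by
    field_simp at h0
    linarith
  have e : ρ ^ (d + 2 + 2) = ρ ^ (d + 2) * ρ ^ 2 := by ring
  rw [e]
  push_cast
  have hd4 : (d : ℝ) + 2 + 2 ≠ 0 := by positivity
  have hd4' : (d : ℝ) + 4 ≠ 0 := by positivity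
  rw [show (d : ℝ) + 2 + 2 = d + 4 by ring] at *
  field_simp
  linear_combination ρ ^ 2 * h1

/-- The integrand is odd under x ↦ -x against an even density. -/
theorem integral_inner (h : IsParabolicProfile A ρ ν) (w : EuclideanSpace ℝ (Fin d)) :
    ∫ x, inner ℝ x w ∂ν = 0 := by
  rw [h.integral_eq]
  have := integral_neg_eq_self (fun x : EuclideanSpace ℝ (Fin d) =>
    parabolicDensity A ρ x * inner ℝ x w) volume
  simp only [parabolicDensity, norm_neg, inner_neg_left, mul_neg, integral_neg] at this
  simp only [parabolicDensity]
  linarith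

theorem integral_norm_affine_sq (h : IsParabolicProfile A ρ ν) (c : ℝ)
    (w : EuclideanSpace ℝ (Fin d)) :
    ∫ x, ‖c • x + w‖ ^ 2 ∂ν = c ^ 2 * (d * ρ ^ 2 / (d + 4)) + ‖w‖ ^ 2 := by
  have := h.isProbabilityMeasure
  have e : ∀ x : EuclideanSpace ℝ (Fin d),
      ‖c • x + w‖ ^ 2 = c ^ 2 * ‖x‖ ^ 2 + 2 * c * inner ℝ x w + ‖w‖ ^ 2 := by
    intro x
    rw [norm_add_sq_real, norm_smul, mul_pow, Real.norm_eq_abs, sq_abs, real_inner_smul_left]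
    ring
  simp only [e]
  rw [integral_add (h.integrable_of_continuous (by fun_prop))
    (h.integrable_of_continuous (by fun_prop)), integral_add
    (h.integrable_of_continuous (by fun_prop)) (h.integrable_of_continuous (by fun_prop)),
    integral_const_mul, integral_const_mul, h.integral_norm_sq, h.integral_inner]
  simp

/-- This is F for the unscaled profile, since ∫ u² = ∫ u dν; on the support the truncation is
inactive and the second moment suffices. -/
theorem integral_density (h : IsParabolicProfile A ρ ν) :
    ∫ x, parabolicDensity A ρ x ∂ν = 4 * A * ρ ^ 2 / (d + 4) := by
  have := h.isProbabilityMeasure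
  have e : ∫ x, parabolicDensity A ρ x ∂ν = ∫ x, A * (ρ ^ 2 - ‖x‖ ^ 2) ∂ν := by
    refine integral_congr_ae ?_
    filter_upwards [h.ae_norm_lt] with x hx
    rw [parabolicDensity, max_eq_left]
    have := pow_le_pow_left₀ (norm_nonneg _) hx.le 2
    linarith
  rw [e, integral_const_mul, integral_sub (integrable_const _)
    (h.integrable_of_continuous (by fun_prop)), h.integral_norm_sq]
  have hd4' : (d : ℝ) + 4 ≠ 0 := by positivity
  simp
  field_simp
  ring

end IsParabolicProfile

/-! ### Density, velocity, F and V of the moving homothety. -/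

/-- The density of `(x ↦ R(t) x + x̄(t))_♯ ν`, for `ν` with parabolic density. -/
def homothetyDensity {d : ℕ} (A ρ : ℝ) (R : ℝ → ℝ) (xbar : ℝ → EuclideanSpace ℝ (Fin d)) (t : ℝ)
    (y : EuclideanSpace ℝ (Fin d)) : ℝ :=
  (R t ^ d)⁻¹ * parabolicDensity A ρ ((R t)⁻¹ • (y - xbar t))

/-- The velocity `(R'/R) (y - x̄) + x̄'` of the flow `x ↦ R(t) x + x̄(t)`. -/
def homothetyVelocity {d : ℕ} (R : ℝ → ℝ) (xbar : ℝ → EuclideanSpace ℝ (Fin d)) (t : ℝ)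
    (y : EuclideanSpace ℝ (Fin d)) : EuclideanSpace ℝ (Fin d) :=
  (deriv R t / R t) • (y - xbar t) + deriv xbar t

/-- `V(t) = R'² dρ²/(d+4) + |x̄'|²`. -/
def homothetyEnergy {d : ℕ} (ρ : ℝ) (R : ℝ → ℝ) (xbar : ℝ → EuclideanSpace ℝ (Fin d)) (t : ℝ) :
    ℝ :=
  deriv R t ^ 2 * (d * ρ ^ 2 / (d + 4)) + ‖deriv xbar t‖ ^ 2

theorem homothetyEnergy_nonneg {d : ℕ} (ρ : ℝ) (R : ℝ → ℝ)
    (xbar : ℝ → EuclideanSpace ℝ (Fin d)) (t : ℝ) : 0 ≤ homothetyEnergy ρ R xbar t := by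
  unfold homothetyEnergy
  positivity

theorem homothetyVelocity_apply {d : ℕ} {R : ℝ → ℝ} {t : ℝ} (hR : R t ≠ 0)
    (xbar : ℝ → EuclideanSpace ℝ (Fin d)) (x : EuclideanSpace ℝ (Fin d)) :
    homothetyVelocity R xbar t (R t • x + xbar t) = deriv R t • x + deriv xbar t := by
  rw [homothetyVelocity, add_sub_cancel_right, smul_smul, div_mul_cancel₀ _ hR]

theorem continuous_homothetyVelocity {d : ℕ} (R : ℝ → ℝ)
    (xbar : ℝ → EuclideanSpace ℝ (Fin d)) (t : ℝ) : Continuous (homothetyVelocity R xbar t) := by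
  unfold homothetyVelocity
  fun_prop

theorem continuous_homothetyDensity {d : ℕ} (A ρ : ℝ) (R : ℝ → ℝ)
    (xbar : ℝ → EuclideanSpace ℝ (Fin d)) (t : ℝ) :
    Continuous (homothetyDensity A ρ R xbar t) := by
  have := continuous_parabolicDensity (d := d) A ρ
  unfold homothetyDensity
  fun_prop

theorem lintegral_comp_smul_add {d : ℕ} {r : ℝ} (hr : 0 < r) (c : EuclideanSpace ℝ (Fin d))
    {f : EuclideanSpace ℝ (Fin d) → ℝ≥0∞} (hf : Measurable f) :
    ∫⁻ x, f (r • x + c) = ENNReal.ofReal (r ^ d)⁻¹ * ∫⁻ y, f y := by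
  have h1 : ∫⁻ x, f (r • x + c) = ∫⁻ y, f (y + c) ∂(Measure.map (r • ·) volume) := by
    rw [lintegral_map (by fun_prop) (by fun_prop)]
  rw [h1, Measure.map_addHaar_smul _ hr.ne', lintegral_smul_measure, lintegral_add_right_eq_self,
    finrank_euclideanSpace_fin, abs_of_pos (by positivity), smul_eq_mul]

namespace IsParabolicProfile

variable {d : ℕ} {A ρ : ℝ} {ν : Measure (EuclideanSpace ℝ (Fin d))} {R : ℝ → ℝ}
  {xbar : ℝ → EuclideanSpace ℝ (Fin d)} {t : ℝ}

theorem isProbabilityMeasure_homothety (h : IsParabolicProfile A ρ ν) (R : ℝ → ℝ)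
    (xbar : ℝ → EuclideanSpace ℝ (Fin d)) (t : ℝ) :
    IsProbabilityMeasure (movingHomothety ν R xbar t) := by
  have := h.isProbabilityMeasure
  exact Measure.isProbabilityMeasure_map (by fun_prop)

theorem memLp_homothety (h : IsParabolicProfile A ρ ν) {F : Type*}
    [NormedAddCommGroup F] {f : EuclideanSpace ℝ (Fin d) → F} (hf : Continuous f) (p : ℝ≥0∞)
    (R : ℝ → ℝ) (xbar : ℝ → EuclideanSpace ℝ (Fin d)) (t : ℝ) :
    MemLp f p (movingHomothety ν R xbar t) := by
  refine (memLp_map_measure_iff hf.aestronglyMeasurable (by fun_prop)).2 ?_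
  exact h.memLp_of_continuous (by fun_prop) p

theorem integral_homothety {F : Type*} [NormedAddCommGroup F] [NormedSpace ℝ F]
    {f : EuclideanSpace ℝ (Fin d) → F} (hf : Continuous f) (ν : Measure (EuclideanSpace ℝ (Fin d)))
    (R : ℝ → ℝ) (xbar : ℝ → EuclideanSpace ℝ (Fin d)) (t : ℝ) :
    ∫ y, f y ∂(movingHomothety ν R xbar t) = ∫ x, f (R t • x + xbar t) ∂ν :=
  integral_map (by fun_prop) hf.aestronglyMeasurable

theorem homothety_eq_withDensity (h : IsParabolicProfile A ρ ν) (hR : 0 < R t) :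
    movingHomothety ν R xbar t
      = volume.withDensity fun y => ENNReal.ofReal (homothetyDensity A ρ R xbar t y) := by
  have hp := (continuous_parabolicDensity (d := d) A ρ).measurable.ennreal_ofReal
  have hq := (continuous_homothetyDensity (d := d) A ρ R xbar t).measurable.ennreal_ofReal
  refine Measure.ext_of_lintegral _ fun f hf => ?_
  rw [movingHomothety, lintegral_map hf (by fun_prop), h.eq_withDensity,
    lintegral_withDensity_eq_lintegral_mul _ hp (by fun_prop),
    lintegral_withDensity_eq_lintegral_mul _ hq hf]
  have key := lintegral_comp_smul_add hR (xbar t)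
    (f := fun y => ENNReal.ofReal (parabolicDensity A ρ ((R t)⁻¹ • (y - xbar t))) * f y)
    (by
      have := continuous_parabolicDensity (d := d) A ρ
      have h2 : Continuous fun y => parabolicDensity A ρ ((R t)⁻¹ • (y - xbar t)) := by fun_prop
      exact h2.measurable.ennreal_ofReal.mul hf)
  simp only [add_sub_cancel_right, smul_smul, inv_mul_cancel₀ hR.ne', one_smul] at key
  simp only [Pi.mul_apply]
  rw [key, ← lintegral_const_mul' _ _ ENNReal.ofReal_ne_top]
  refine lintegral_congr fun y => ?_
  rw [homothetyDensity, ENNReal.ofReal_mul (by positivity), mul_assoc]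

theorem homothetyDensity_nonneg (h : IsParabolicProfile A ρ ν) (hR : 0 < R t)
    (y : EuclideanSpace ℝ (Fin d)) : 0 ≤ homothetyDensity A ρ R xbar t y :=
  mul_nonneg (by positivity) (h.density_nonneg _)

theorem homothetyDensity_pos_iff (h : IsParabolicProfile A ρ ν) (hR : 0 < R t)
    {y : EuclideanSpace ℝ (Fin d)} :
    0 < homothetyDensity A ρ R xbar t y ↔ ‖y - xbar t‖ < R t * ρ := by
  rw [homothetyDensity, mul_pos_iff_of_pos_left (by positivity), h.density_pos_iff, norm_smul,
    norm_inv, Real.norm_of_nonneg hR.le, inv_mul_lt_iff₀ hR]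

/-- Writing ∫ u² dy as ∫ u dμ_t and pulling back to the fixed measure ν turns u into R⁻ᵈ times the
profile, which gives the scaling R⁻ᵈ. -/
theorem densityFunctional_homothety (h : IsParabolicProfile A ρ ν) (hR : 0 < R t) :
    densityFunctional 2 (movingHomothety ν R xbar t)
      = ENNReal.ofReal ((R t ^ d)⁻¹ * (4 * A * ρ ^ 2 / (d + 4))) := by
  have hq := (continuous_homothetyDensity (d := d) A ρ R xbar t).measurable.ennreal_ofReal
  have hμ := h.homothety_eq_withDensity (xbar := xbar) hR
  have hac : movingHomothety ν R xbar t ≪ volume := by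
    rw [hμ]
    exact withDensity_absolutelyContinuous _ _
  have h1 : ∫⁻ y, (movingHomothety ν R xbar t).rnDeriv volume y ^ (2 : ℝ)
      = ∫⁻ y, ENNReal.ofReal (homothetyDensity A ρ R xbar t y)
          * ENNReal.ofReal (homothetyDensity A ρ R xbar t y) := by
    refine lintegral_congr_ae ?_
    have := Measure.rnDeriv_withDensity volume hq
    rw [← hμ] at this
    filter_upwards [this] with y hy
    rw [hy, ENNReal.rpow_two, sq]
  have h2 : ∫⁻ y, ENNReal.ofReal (homothetyDensity A ρ R xbar t y)
          * ENNReal.ofReal (homothetyDensity A ρ R xbar t y)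
      = ∫⁻ y, ENNReal.ofReal (homothetyDensity A ρ R xbar t y)
          ∂(movingHomothety ν R xbar t) := by
    conv_rhs => rw [hμ]
    rw [lintegral_withDensity_eq_lintegral_mul _ hq hq]
    rfl
  rw [densityFunctional, if_pos hac, h1, h2, movingHomothety, lintegral_map hq (by fun_prop)]
  have h3 : ∀ x, homothetyDensity A ρ R xbar t (R t • x + xbar t)
      = (R t ^ d)⁻¹ * parabolicDensity A ρ x := by
    intro x
    rw [homothetyDensity, add_sub_cancel_right, smul_smul, inv_mul_cancel₀ hR.ne', one_smul]
  have hp := continuous_parabolicDensity (d := d) A ρ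
  simp only [h3]
  rw [← ofReal_integral_eq_lintegral_ofReal (h.integrable_of_continuous (by fun_prop))
    (.of_forall fun x => mul_nonneg (by positivity) (h.density_nonneg x)),
    integral_const_mul, h.integral_density]

theorem kineticV_homothety (h : IsParabolicProfile A ρ ν) (hR : 0 < R t)
    {w : ℝ → EuclideanSpace ℝ (Fin d) → EuclideanSpace ℝ (Fin d)}
    (hw : w t =ᵐ[movingHomothety ν R xbar t] homothetyVelocity R xbar t) :
    kineticV (movingHomothety ν R xbar) w t = ENNReal.ofReal (homothetyEnergy ρ R xbar t) := by
  have h1 : kineticV (movingHomothety ν R xbar) w t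
      = ∫⁻ y, ‖homothetyVelocity R xbar t y‖ₑ ^ 2 ∂(movingHomothety ν R xbar t) := by
    refine lintegral_congr_ae ?_
    filter_upwards [hw] with y hy
    rw [hy]
  have hc := continuous_homothetyVelocity R xbar t
  rw [h1, movingHomothety, lintegral_map (by fun_prop) (by fun_prop)]
  simp only [homothetyVelocity_apply hR.ne']
  have h2 : ∀ x : EuclideanSpace ℝ (Fin d), ‖deriv R t • x + deriv xbar t‖ₑ ^ 2
      = ENNReal.ofReal (‖deriv R t • x + deriv xbar t‖ ^ 2) := by
    intro x
    rw [ENNReal.ofReal_pow (norm_nonneg _), ofReal_norm]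
  simp only [h2]
  rw [← ofReal_integral_eq_lintegral_ofReal (h.integrable_of_continuous (by fun_prop))
    (.of_forall fun x => by positivity), h.integral_norm_affine_sq]
  rfl

/-- This is F = K√V squared. If V = 0, both sides are false: the coefficient is infinite on the
left, while on the right 0 would equal a positive number. -/
theorem coefficientK_homothety_eq_iff (h : IsParabolicProfile A ρ ν) (hR : 0 < R t)
    {w : ℝ → EuclideanSpace ℝ (Fin d) → EuclideanSpace ℝ (Fin d)}
    (hw : w t =ᵐ[movingHomothety ν R xbar t] homothetyVelocity R xbar t) {K : ℝ} (hK : 0 < K) :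
    coefficientK (movingHomothety ν R xbar) w t = ENNReal.ofReal K ↔
      R t ^ (2 * d) * homothetyEnergy ρ R xbar t = (4 * A * ρ ^ 2 / (d + 4)) ^ 2 / K ^ 2 := by
  rw [coefficientK, h.densityFunctional_homothety hR, h.kineticV_homothety hR hw]
  have hA := h.amplitude_pos
  have hρ := h.radius_pos
  set F₀ := 4 * A * ρ ^ 2 / ((d : ℝ) + 4) with hF
  have hF₀ : 0 < F₀ := by positivity
  rcases (homothetyEnergy_nonneg ρ R xbar t).eq_or_lt with hV | hV
  · rw [← hV]
    have : ENNReal.ofReal ((R t ^ d)⁻¹ * F₀) ≠ 0 := by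
      rw [Ne, ENNReal.ofReal_eq_zero, not_le]
      positivity
    rw [ENNReal.ofReal_zero, ENNReal.zero_rpow_of_neg (by norm_num), ENNReal.mul_top this,
      mul_zero]
    have h2 : 0 < F₀ ^ 2 / K ^ 2 := by positivity
    exact ⟨fun h => absurd h.symm ENNReal.ofReal_ne_top, fun h => absurd h h2.ne⟩
  · set V := homothetyEnergy ρ R xbar t
    have hs : 0 < √V := Real.sqrt_pos.2 hV
    have hsq : √V ^ 2 = V := Real.sq_sqrt hV.le
    rw [ENNReal.ofReal_rpow_of_pos hV, ← ENNReal.ofReal_mul (by positivity),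
      ENNReal.ofReal_eq_ofReal_iff (by positivity) hK.le, Real.rpow_neg hV.le,
      ← Real.sqrt_eq_rpow]
    have hRd : 0 < R t ^ d := by positivity
    have e : R t ^ (2 * d) * V = (R t ^ d * √V) ^ 2 := by
      rw [mul_pow, hsq, ← pow_mul, mul_comm d 2]
    rw [e, ← div_pow, sq_eq_sq₀ (by positivity) (by positivity), eq_div_iff hK.ne']
    constructor
    · intro h
      rw [← h]
      field_simp
    · intro h
      rw [← h]
      field_simp

end IsParabolicProfile

/-! ### Differentiating ∫ φ dμ_t along the flow. -/

/-- The regularity of the scale `R` and of the centre `x̄` of a moving homothety. -/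
structure IsHomothetyPath {d : ℕ} (R : ℝ → ℝ) (xbar : ℝ → EuclideanSpace ℝ (Fin d)) : Prop where
  scale_continuousOn : ContinuousOn R (Icc 0 1)
  scale_contDiffOn : ContDiffOn ℝ 2 R (Ioo 0 1)
  scale_pos : ∀ t ∈ Ioo (0 : ℝ) 1, 0 < R t
  center_continuousOn : ContinuousOn xbar (Icc 0 1)
  center_contDiffOn : ContDiffOn ℝ 2 xbar (Ioo 0 1)

theorem contDiffOn_deriv_of_two {F : Type*} [NormedAddCommGroup F] [NormedSpace ℝ F] {f : ℝ → F}
    {s : Set ℝ} (hs : IsOpen s) (hf : ContDiffOn ℝ 2 f s) : ContDiffOn ℝ 1 (deriv f) s :=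
  hf.deriv_of_isOpen hs (by norm_num [one_add_one_eq_two])

theorem hasDerivAt_of_contDiffOn {F : Type*} [NormedAddCommGroup F] [NormedSpace ℝ F] {f : ℝ → F}
    {s : Set ℝ} (hs : IsOpen s) {n : WithTop ℕ∞} (hf : ContDiffOn ℝ n f s) (hn : n ≠ 0) {t : ℝ}
    (ht : t ∈ s) : HasDerivAt f (deriv f t) t :=
  ((hf.differentiableOn hn).differentiableAt (hs.mem_nhds ht)).hasDerivAt

theorem continuous_gradient {F : Type*} [NormedAddCommGroup F] [InnerProductSpace ℝ F]
    [CompleteSpace F] {φ : F → ℝ} (hφ : ContDiff ℝ 1 φ) : Continuous (gradient φ) :=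
  (InnerProductSpace.toDual ℝ F).symm.continuous.comp (hφ.continuous_fderiv (by norm_num))

namespace IsHomothetyPath

variable {d : ℕ} {A ρ : ℝ} {ν : Measure (EuclideanSpace ℝ (Fin d))} {R : ℝ → ℝ}
  {xbar : ℝ → EuclideanSpace ℝ (Fin d)}

theorem hasDerivAt_scale (c : IsHomothetyPath R xbar) {t : ℝ} (ht : t ∈ Ioo (0 : ℝ) 1) :
    HasDerivAt R (deriv R t) t :=
  hasDerivAt_of_contDiffOn isOpen_Ioo c.scale_contDiffOn (by norm_num) ht

theorem hasDerivAt_center (c : IsHomothetyPath R xbar) {t : ℝ} (ht : t ∈ Ioo (0 : ℝ) 1) :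
    HasDerivAt xbar (deriv xbar t) t :=
  hasDerivAt_of_contDiffOn isOpen_Ioo c.center_contDiffOn (by norm_num) ht

theorem contDiffOn_deriv_scale (c : IsHomothetyPath R xbar) : ContDiffOn ℝ 1 (deriv R) (Ioo 0 1) :=
  contDiffOn_deriv_of_two isOpen_Ioo c.scale_contDiffOn

theorem contDiffOn_deriv_center (c : IsHomothetyPath R xbar) :
    ContDiffOn ℝ 1 (deriv xbar) (Ioo 0 1) :=
  contDiffOn_deriv_of_two isOpen_Ioo c.center_contDiffOn

/-- Integration over the fixed measure ν makes sense even at end points where R vanishes; domination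
comes from the compact support of ν. -/
theorem continuousOn_integral (c : IsHomothetyPath R xbar) (h : IsParabolicProfile A ρ ν)
    {φ : EuclideanSpace ℝ (Fin d) → ℝ} (hφ : Continuous φ) :
    ContinuousOn (fun t => ∫ x, φ x ∂(movingHomothety ν R xbar t)) (Icc 0 1) := by
  have := h.isProbabilityMeasure
  simp only [IsParabolicProfile.integral_homothety hφ]
  have hR := c.scale_continuousOn
  have hx := c.center_continuousOn
  have hjoint : ContinuousOn (fun p : ℝ × EuclideanSpace ℝ (Fin d) => φ (R p.1 • p.2 + xbar p.1))
      (Icc 0 1 ×ˢ Metric.closedBall 0 ρ) := by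
    refine hφ.comp_continuousOn ?_
    have h1 : ContinuousOn (fun p : ℝ × EuclideanSpace ℝ (Fin d) => R p.1)
        (Icc 0 1 ×ˢ Metric.closedBall 0 ρ) := hR.comp continuousOn_fst fun p hp => hp.1
    have h2 : ContinuousOn (fun p : ℝ × EuclideanSpace ℝ (Fin d) => xbar p.1)
        (Icc 0 1 ×ˢ Metric.closedBall 0 ρ) := hx.comp continuousOn_fst fun p hp => hp.1
    exact (h1.smul continuousOn_snd).add h2
  obtain ⟨C, hC⟩ := (isCompact_Icc.prod (isCompact_closedBall _ _)).exists_bound_of_continuousOn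
    hjoint
  refine continuousOn_of_dominated (bound := fun _ => C) (fun t _ => ?_) (fun t ht => ?_)
    (integrable_const C) (.of_forall fun x => ?_)
  · exact Continuous.aestronglyMeasurable (by fun_prop)
  · filter_upwards [h.ae_norm_lt] with x hx
    exact hC (t, x) ⟨ht, by simpa using hx.le⟩
  · exact hφ.comp_continuousOn (by fun_prop)

/-- Differentiation under the integral sign over ν. The derivatives of R and x̄ may blow up at 0 and
1, so the bound is taken on a compact time window inside (0,1). -/
theorem hasDerivAt_integral (c : IsHomothetyPath R xbar) (h : IsParabolicProfile A ρ ν)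
    {φ : EuclideanSpace ℝ (Fin d) → ℝ} (hφ : ContDiff ℝ 1 φ) {t : ℝ} (ht : t ∈ Ioo (0 : ℝ) 1) :
    HasDerivAt (fun t => ∫ x, φ x ∂(movingHomothety ν R xbar t))
      (∫ x, inner ℝ (gradient φ x) (homothetyVelocity R xbar t x)
        ∂(movingHomothety ν R xbar t)) t := by
  have := h.isProbabilityMeasure
  have hg := continuous_gradient hφ
  have hv := continuous_homothetyVelocity R xbar t
  simp only [IsParabolicProfile.integral_homothety hφ.continuous]
  rw [IsParabolicProfile.integral_homothety (by fun_prop)]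
  simp only [homothetyVelocity_apply (c.scale_pos t ht).ne']
  obtain ⟨ε, hε, hεs⟩ := Metric.isOpen_iff.1 isOpen_Ioo t ht
  have hs : Icc (t - ε / 2) (t + ε / 2) ⊆ Ioo 0 1 := fun s hs => by
    refine hεs ?_
    rw [Metric.mem_ball, Real.dist_eq, abs_lt]
    constructor <;> linarith [hs.1, hs.2]
  set I := Icc (t - ε / 2) (t + ε / 2) with hI
  have hnhds : I ∈ 𝓝 t := Icc_mem_nhds (by linarith) (by linarith)
  have hjoint : ContinuousOn (fun p : ℝ × EuclideanSpace ℝ (Fin d) =>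
      (inner ℝ (gradient φ (R p.1 • p.2 + xbar p.1)) (deriv R p.1 • p.2 + deriv xbar p.1) : ℝ))
      (I ×ˢ Metric.closedBall 0 ρ) := by
    have lift : ∀ {F : Type} [TopologicalSpace F] {g : ℝ → F}, ContinuousOn g (Ioo 0 1) →
        ContinuousOn (fun p : ℝ × EuclideanSpace ℝ (Fin d) => g p.1)
          (I ×ˢ Metric.closedBall 0 ρ) := fun hg =>
      hg.comp continuousOn_fst fun p hp => hs hp.1
    have h1 := lift c.scale_contDiffOn.continuousOn
    have h2 := lift c.center_contDiffOn.continuousOn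
    have h3 := lift c.contDiffOn_deriv_scale.continuousOn
    have h4 := lift c.contDiffOn_deriv_center.continuousOn
    have h5 : ContinuousOn (fun p : ℝ × EuclideanSpace ℝ (Fin d) =>
      gradient φ (R p.1 • p.2 + xbar p.1)) (I ×ˢ Metric.closedBall 0 ρ) :=
      hg.comp_continuousOn ((h1.smul continuousOn_snd).add h2)
    exact h5.inner ((h3.smul continuousOn_snd).add h4)
  obtain ⟨C, hC⟩ := (isCompact_Icc.prod (isCompact_closedBall _ _)).exists_bound_of_continuousOn
    hjoint
  refine (hasDerivAt_integral_of_dominated_loc_of_deriv_le (bound := fun _ => C)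
    (F' := fun s x => inner ℝ (gradient φ (R s • x + xbar s)) (deriv R s • x + deriv xbar s))
    hnhds (.of_forall fun s => ?_) (h.integrable_of_continuous ?_) ?_ ?_ (integrable_const C)
    (.of_forall fun x s hsI => ?_)).2
  · exact (hφ.continuous.comp (by fun_prop)).aestronglyMeasurable
  · exact hφ.continuous.comp (by fun_prop)
  · exact Continuous.aestronglyMeasurable (by fun_prop)
  · filter_upwards [h.ae_norm_lt] with x hx s hs
    exact hC (s, x) ⟨hs, by simpa using hx.le⟩
  · rw [inner_gradient_left]
    have hφd := (hφ.differentiable (by norm_num) (R s • x + xbar s)).hasFDerivAt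
    exact hφd.comp_hasDerivAt s
      (((c.hasDerivAt_scale (hs hsI)).smul_const x).add (c.hasDerivAt_center (hs hsI)))

/-- The derivatives of `∫ φ dμ_t` along two velocity fields agree almost everywhere. -/
theorem ae_integral_gradient_eq (c : IsHomothetyPath R xbar) (h : IsParabolicProfile A ρ ν)
    {w : ℝ → EuclideanSpace ℝ (Fin d) → EuclideanSpace ℝ (Fin d)}
    (hw : IsVelocityField (movingHomothety ν R xbar) w)
    {φ : EuclideanSpace ℝ (Fin d) → ℝ} (hφ : ContDiff ℝ 1 φ) (hφc : HasCompactSupport φ) :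
    ∀ᵐ t ∂(volume.restrict (Icc (0 : ℝ) 1)),
      ∫ x, inner ℝ (gradient φ x) (w t x) ∂(movingHomothety ν R xbar t)
        = ∫ x, inner ℝ (gradient φ x) (homothetyVelocity R xbar t x)
            ∂(movingHomothety ν R xbar t) := by
  have h01 := hw.2 φ hφ hφc 0 (by simp) 1 (by simp) one_pos
  -- Lebesgue differentiation: for a.e. t the time integral in the continuity equation has its
  -- integrand as derivative, while the flow gives another formula for the same derivative.
  rw [← Measure.restrict_congr_set Ioo_ae_eq_Icc, ae_restrict_iff' measurableSet_Ioo]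
  filter_upwards [h01.1.ae_hasDerivAt_integral] with t ht htI
  rw [uIcc_of_le zero_le_one] at ht
  have h1 := ht (Ioo_subset_Icc_self htI) 0 (by simp)
  have h2 := (c.hasDerivAt_integral h hφ htI).sub_const
    (∫ x, φ x ∂(movingHomothety ν R xbar 0))
  refine h1.unique (h2.congr_of_eventuallyEq ?_)
  filter_upwards [Ioo_mem_nhds htI.1 htI.2] with s hs
  exact (hw.2 φ hφ hφc 0 (by simp) s (Ioo_subset_Icc_self hs) hs.1).2.symm

theorem memLp_homothetyVelocity (h : IsParabolicProfile A ρ ν) (R : ℝ → ℝ)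
    (xbar : ℝ → EuclideanSpace ℝ (Fin d)) (t : ℝ) :
    MemLp (homothetyVelocity R xbar t) 2 (movingHomothety ν R xbar t) :=
  h.memLp_homothety (continuous_homothetyVelocity R xbar t) 2 R xbar t

/-- If the curve has a velocity field at all, then the velocity of the flow is one. -/
theorem isVelocityField_of_exists (c : IsHomothetyPath R xbar) (h : IsParabolicProfile A ρ ν)
    {w : ℝ → EuclideanSpace ℝ (Fin d) → EuclideanSpace ℝ (Fin d)}
    (hw : IsVelocityField (movingHomothety ν R xbar) w) :
    IsVelocityField (movingHomothety ν R xbar) (homothetyVelocity R xbar) := by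
  refine ⟨.of_forall fun t => memLp_homothetyVelocity h R xbar t, ?_⟩
  intro φ hφ hφc t₁ ht₁ t₂ ht₂ h12
  obtain ⟨hint, heq⟩ := hw.2 φ hφ hφc t₁ ht₁ t₂ ht₂ h12
  have hae := c.ae_integral_gradient_eq h hw hφ hφc
  have hsub : uIoc t₁ t₂ ⊆ Icc 0 1 := by
    rw [uIoc_of_le h12.le]
    exact fun s hs => ⟨ht₁.1.trans hs.1.le, hs.2.trans ht₂.2⟩
  have hae' :=
    ae_restrict_of_ae_restrict_of_subset hsub hae
  -- Integrability in time is inherited from `w`, so nothing is needed about R' and x̄' near the end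
  -- points.
  refine ⟨hint.congr_ae hae', ?_⟩
  rw [heq]
  exact intervalIntegral.integral_congr_ae_restrict hae'

end IsHomothetyPath

/-! ### Orthogonality in L² and identification of the tangent field. -/

theorem integrable_inner_of_memLp {α F : Type*} [MeasurableSpace α] {μ : Measure α}
    [NormedAddCommGroup F] [InnerProductSpace ℝ F] {f g : α → F} (hf : MemLp f 2 μ)
    (hg : MemLp g 2 μ) : Integrable (fun x => (inner ℝ (f x) (g x) : ℝ)) μ := by
  refine (L2.integrable_inner (𝕜 := ℝ) (hf.toLp f) (hg.toLp g)).congr ?_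
  filter_upwards [hf.coeFn_toLp, hg.coeFn_toLp] with x h1 h2
  rw [h1, h2]

/-- Pythagoras in `L²`: if `w - v` is orthogonal to `v`, then `v` has the smaller norm, and the
norms agree only if the fields do. -/
theorem eLpNorm_le_of_integral_inner_sub_eq_zero {α F : Type*} [MeasurableSpace α]
    {μ : Measure α} [NormedAddCommGroup F] [InnerProductSpace ℝ F] {v w : α → F}
    (hv : MemLp v 2 μ) (hw : MemLp w 2 μ) (h : ∫ x, inner ℝ (v x) (w x - v x) ∂μ = 0) :
    eLpNorm v 2 μ ≤ eLpNorm w 2 μ ∧ (eLpNorm w 2 μ ≤ eLpNorm v 2 μ → w =ᵐ[μ] v) := by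
  set V := hv.toLp v with hV
  set D := (hw.sub hv).toLp (w - v) with hD
  have hWV : hw.toLp w = V + D := by
    rw [hD, MemLp.toLp_sub hw hv]
    abel
  have horth : inner ℝ V D = 0 := by
    rw [L2.inner_def, ← h]
    refine integral_congr_ae ?_
    filter_upwards [hv.coeFn_toLp, (hw.sub hv).coeFn_toLp] with x h1 h2
    rw [h1, h2]
    rfl
  have hpyth : ‖hw.toLp w‖ * ‖hw.toLp w‖ = ‖V‖ * ‖V‖ + ‖D‖ * ‖D‖ := by
    rw [hWV]
    exact norm_add_sq_eq_norm_sq_add_norm_sq_real horth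
  have hnV : ‖V‖ = (eLpNorm v 2 μ).toReal := Lp.norm_toLp v hv
  have hnW : ‖hw.toLp w‖ = (eLpNorm w 2 μ).toReal := Lp.norm_toLp w hw
  constructor
  · rw [← ENNReal.toReal_le_toReal hv.2.ne hw.2.ne, ← hnV, ← hnW]
    nlinarith [norm_nonneg V, norm_nonneg (hw.toLp w), norm_nonneg D]
  · intro hle
    rw [← ENNReal.toReal_le_toReal hw.2.ne hv.2.ne, ← hnV, ← hnW] at hle
    have hD0 : ‖D‖ = 0 := by
      nlinarith [norm_nonneg V, norm_nonneg (hw.toLp w), norm_nonneg D]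
    rw [norm_eq_zero] at hD0
    rw [hD0, add_zero] at hWV
    exact (MemLp.toLp_eq_toLp_iff hw hv).1 hWV

theorem gradient_inner_left {F : Type*} [NormedAddCommGroup F] [InnerProductSpace ℝ F]
    [CompleteSpace F] (e x : F) : gradient (fun y : F => (inner ℝ e y : ℝ)) x = e := by
  refine HasGradientAt.gradient ?_
  rw [hasGradientAt_iff_hasFDerivAt]
  exact (innerSL ℝ e).hasFDerivAt

theorem gradient_norm_sq {F : Type*} [NormedAddCommGroup F] [InnerProductSpace ℝ F]
    [CompleteSpace F] (x : F) : gradient (fun y : F => ‖y‖ ^ 2) x = (2 : ℝ) • x := by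
  refine HasGradientAt.gradient ?_
  rw [hasGradientAt_iff_hasFDerivAt]
  have e : (InnerProductSpace.toDual ℝ F) ((2 : ℝ) • x) = 2 • innerSL ℝ x := by
    ext y
    simp
  rw [e]
  exact (hasStrictFDerivAt_norm_sq x).hasFDerivAt

namespace IsHomothetyPath

variable {d : ℕ} {A ρ : ℝ} {ν : Measure (EuclideanSpace ℝ (Fin d))} {R : ℝ → ℝ}
  {xbar : ℝ → EuclideanSpace ℝ (Fin d)}

theorem exists_bound (c : IsHomothetyPath R xbar) (h : IsParabolicProfile A ρ ν) :
    ∃ M : ℝ, 0 < M ∧ ∀ t ∈ Icc (0 : ℝ) 1, ∀ᵐ y ∂(movingHomothety ν R xbar t), ‖y‖ < M := by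
  obtain ⟨C₁, h₁⟩ := isCompact_Icc.exists_bound_of_continuousOn c.scale_continuousOn
  obtain ⟨C₂, h₂⟩ := isCompact_Icc.exists_bound_of_continuousOn c.center_continuousOn
  have hρ := h.radius_pos
  have p₁ := (norm_nonneg _).trans (h₁ 0 (by simp))
  have p₂ := (norm_nonneg _).trans (h₂ 0 (by simp))
  refine ⟨C₁ * ρ + C₂ + 1, by positivity, fun t ht => ?_⟩
  rw [movingHomothety, ae_map_iff (by fun_prop)
    (measurableSet_lt (by fun_prop) (by fun_prop))]
  filter_upwards [h.ae_norm_lt] with x hx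
  calc ‖R t • x + xbar t‖ ≤ ‖R t‖ * ‖x‖ + ‖xbar t‖ := by
        rw [← norm_smul]
        exact norm_add_le _ _
    _ ≤ C₁ * ρ + C₂ := add_le_add (mul_le_mul (h₁ t ht) hx.le (norm_nonneg _) p₁) (h₂ t ht)
    _ < C₁ * ρ + C₂ + 1 := lt_add_one _

/-- Since the curve has compactly supported mass, `ae_integral_gradient_eq` holds for test
functions of arbitrary support. -/
theorem ae_integral_gradient_eq_of_contDiff (c : IsHomothetyPath R xbar)
    (h : IsParabolicProfile A ρ ν)
    {w : ℝ → EuclideanSpace ℝ (Fin d) → EuclideanSpace ℝ (Fin d)}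
    (hw : IsVelocityField (movingHomothety ν R xbar) w)
    {φ : EuclideanSpace ℝ (Fin d) → ℝ} (hφ : ContDiff ℝ 1 φ) :
    ∀ᵐ t ∂(volume.restrict (Icc (0 : ℝ) 1)),
      ∫ x, inner ℝ (gradient φ x) (w t x) ∂(movingHomothety ν R xbar t)
        = ∫ x, inner ℝ (gradient φ x) (homothetyVelocity R xbar t x)
            ∂(movingHomothety ν R xbar t) := by
  obtain ⟨M, hM, hsupp⟩ := c.exists_bound h
  -- A cut-off equal to 1 on the ball of radius `M`, which carries every μ_t, alters neither side of
  -- the identity.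
  let χ : ContDiffBump (0 : EuclideanSpace ℝ (Fin d)) := ⟨M, M + 1, hM, lt_add_one M⟩
  have hgrad : ∀ y : EuclideanSpace ℝ (Fin d), ‖y‖ < M →
      gradient (fun x => χ x * φ x) y = gradient φ y := by
    intro y hy
    refine Filter.EventuallyEq.gradient_eq ?_
    filter_upwards [χ.eventuallyEq_one_of_mem_ball (by simpa using hy)] with z hz
    rw [hz]
    simp
  have key := c.ae_integral_gradient_eq h hw (φ := fun x => χ x * φ x)
    ((χ.contDiff (n := 1)).mul hφ) (χ.hasCompactSupport.mul_right)
  filter_upwards [key, ae_restrict_mem measurableSet_Icc] with t ht htI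
  have e : ∀ f : EuclideanSpace ℝ (Fin d) → EuclideanSpace ℝ (Fin d),
      ∫ x, inner ℝ (gradient (fun x => χ x * φ x) x) (f x) ∂(movingHomothety ν R xbar t)
        = ∫ x, inner ℝ (gradient φ x) (f x) ∂(movingHomothety ν R xbar t) := fun f => by
    refine integral_congr_ae ?_
    filter_upwards [hsupp t htI] with y hy
    rw [hgrad y hy]
  rwa [e, e] at ht

/-- The velocity of the flow is a combination of the constant fields and of y, that is, of gradients
of the coordinates and of |y|². These d + 1 test functions suffice, so one null set of times serves
them all. -/
theorem ae_integral_inner_sub_eq_zero (c : IsHomothetyPath R xbar)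
    (h : IsParabolicProfile A ρ ν)
    {w : ℝ → EuclideanSpace ℝ (Fin d) → EuclideanSpace ℝ (Fin d)}
    (hw : IsVelocityField (movingHomothety ν R xbar) w) :
    ∀ᵐ t ∂(volume.restrict (Icc (0 : ℝ) 1)),
      ∫ x, inner ℝ (homothetyVelocity R xbar t x) (w t x - homothetyVelocity R xbar t x)
        ∂(movingHomothety ν R xbar t) = 0 := by
  have hcoord := ae_all_iff.2 fun i : Fin d => c.ae_integral_gradient_eq_of_contDiff h hw
    (φ := fun y => inner ℝ (EuclideanSpace.single i (1 : ℝ)) y) (contDiff_const.inner ℝ contDiff_id)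
  have hquad := c.ae_integral_gradient_eq_of_contDiff h hw
    (φ := fun y => ‖y‖ ^ 2) (contDiff_norm_sq ℝ)
  filter_upwards [hcoord, hquad, hw.1] with t h1 h2 hwt
  have hprob := h.isProbabilityMeasure_homothety R xbar t
  set μt := movingHomothety ν R xbar t
  have hvt := memLp_homothetyVelocity h R xbar t
  set D : EuclideanSpace ℝ (Fin d) → EuclideanSpace ℝ (Fin d) :=
    fun x => w t x - homothetyVelocity R xbar t x with hD
  have hDt : MemLp D 2 μt := hwt.sub hvt
  have hint : ∀ {f : EuclideanSpace ℝ (Fin d) → EuclideanSpace ℝ (Fin d)}, Continuous f →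
      Integrable (fun x => (inner ℝ (f x) (D x) : ℝ)) μt := fun hf =>
    integrable_inner_of_memLp (h.memLp_homothety hf 2 R xbar t) hDt
  have hsub : ∀ {f : EuclideanSpace ℝ (Fin d) → EuclideanSpace ℝ (Fin d)}, Continuous f →
      ∫ x, inner ℝ (f x) (w t x) ∂μt
        = ∫ x, inner ℝ (f x) (homothetyVelocity R xbar t x) ∂μt →
      ∫ x, inner ℝ (f x) (D x) ∂μt = 0 := fun hf he => by
    have hf2 := h.memLp_homothety hf 2 R xbar t
    simp only [hD, inner_sub_right]
    rw [integral_sub (integrable_inner_of_memLp hf2 hwt) (integrable_inner_of_memLp hf2 hvt), he,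
      sub_self]
  have hmean : ∫ x, D x ∂μt = 0 := by
    ext i
    have h3 := h1 i
    simp only [gradient_inner_left] at h3
    have h4 := hsub continuous_const h3
    rw [integral_inner (hDt.integrable (by norm_num))] at h4
    simpa [EuclideanSpace.inner_single_left] using h4
  have hlin : ∫ x, inner ℝ x (D x) ∂μt = 0 := by
    simp only [gradient_norm_sq] at h2
    have h4 := hsub (continuous_id.const_smul (2 : ℝ)) h2
    simp only [Pi.smul_apply, id, real_inner_smul_left, integral_const_mul] at h4
    linarith
  have e : ∀ x, (inner ℝ (homothetyVelocity R xbar t x) (D x) : ℝ)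
      = deriv R t / R t * inner ℝ x (D x)
        + inner ℝ (deriv xbar t - (deriv R t / R t) • xbar t) (D x) := by
    intro x
    rw [homothetyVelocity, smul_sub, inner_add_left, inner_sub_left, inner_sub_left,
      real_inner_smul_left]
    ring
  rw [integral_congr_ae (.of_forall e),
    integral_add ((hint (f := fun x => x) continuous_id).const_mul _) (hint continuous_const),
    integral_const_mul, hlin, integral_inner (hDt.integrable (by norm_num)), hmean]
  simp

/-- If the curve has a velocity field at all, then the velocity of the flow is tangent. -/
theorem isTangentField_of_exists (c : IsHomothetyPath R xbar) (h : IsParabolicProfile A ρ ν)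
    {w : ℝ → EuclideanSpace ℝ (Fin d) → EuclideanSpace ℝ (Fin d)}
    (hw : IsVelocityField (movingHomothety ν R xbar) w) :
    IsTangentField (movingHomothety ν R xbar) (homothetyVelocity R xbar) := by
  refine ⟨c.isVelocityField_of_exists h hw, fun w' hw' => ?_⟩
  filter_upwards [c.ae_integral_inner_sub_eq_zero h hw', hw'.1] with t h1 h2
  exact (eLpNorm_le_of_integral_inner_sub_eq_zero (memLp_homothetyVelocity h R xbar t) h2 h1).1

/-- Every tangent field agrees with the velocity of the flow. -/
theorem ae_eq_of_isTangentField (c : IsHomothetyPath R xbar) (h : IsParabolicProfile A ρ ν)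
    {w : ℝ → EuclideanSpace ℝ (Fin d) → EuclideanSpace ℝ (Fin d)}
    (hw : IsTangentField (movingHomothety ν R xbar) w) :
    ∀ᵐ t ∂(volume.restrict (Icc (0 : ℝ) 1)),
      w t =ᵐ[movingHomothety ν R xbar t] homothetyVelocity R xbar t := by
  filter_upwards [c.ae_integral_inner_sub_eq_zero h hw.1, hw.1.1,
    hw.2 _ (c.isVelocityField_of_exists h hw.1)] with t h1 h2 h3
  exact (eLpNorm_le_of_integral_inner_sub_eq_zero (memLp_homothetyVelocity h R xbar t) h2 h1).2 h3

theorem ae_restrict_Ioo {p : ℝ → Prop} (hp : ∀ᵐ t ∂(volume.restrict (Icc (0 : ℝ) 1)), p t) :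
    ∀ᵐ t ∂(volume.restrict (Ioo (0 : ℝ) 1)), p t :=
  ae_restrict_of_ae_restrict_of_subset Ioo_subset_Icc_self hp

/-! ### Constancy of K as a conservation law. -/

theorem continuousOn_energy (c : IsHomothetyPath R xbar) (ρ : ℝ) :
    ContinuousOn (fun t => R t ^ (2 * d) * homothetyEnergy ρ R xbar t) (Ioo 0 1) := by
  have h1 := c.scale_contDiffOn.continuousOn
  have h2 := c.contDiffOn_deriv_scale.continuousOn
  have h3 := c.contDiffOn_deriv_center.continuousOn
  unfold homothetyEnergy
  fun_prop

/-- `K` is constant along the curve iff `R^{2d} V` is, and then everywhere on `(0,1)`. -/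
theorem energy_eq_of_hasConstantK (c : IsHomothetyPath R xbar) (h : IsParabolicProfile A ρ ν)
    {K : ℝ} (hK : HasConstantK (movingHomothety ν R xbar) K) {t : ℝ} (ht : t ∈ Ioo (0 : ℝ) 1) :
    R t ^ (2 * d) * homothetyEnergy ρ R xbar t = (4 * A * ρ ^ 2 / (d + 4)) ^ 2 / K ^ 2 := by
  obtain ⟨hK0, w, hw, hwK⟩ := hK
  have hae : (fun t => R t ^ (2 * d) * homothetyEnergy ρ R xbar t)
      =ᵐ[volume.restrict (Ioo 0 1)] fun _ => (4 * A * ρ ^ 2 / (d + 4)) ^ 2 / K ^ 2 := by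
    filter_upwards [ae_restrict_Ioo hwK, ae_restrict_Ioo (c.ae_eq_of_isTangentField h hw),
      ae_restrict_mem measurableSet_Ioo] with s h1 h2 hs
    exact (h.coefficientK_homothety_eq_iff (c.scale_pos s hs) h2 hK0).1 h1
  exact Measure.eqOn_open_of_ae_eq hae isOpen_Ioo (c.continuousOn_energy ρ) continuousOn_const ht

theorem hasConstantK_of_energy_eq (c : IsHomothetyPath R xbar) (h : IsParabolicProfile A ρ ν)
    {K : ℝ} (hK : 0 < K)
    (hv : IsTangentField (movingHomothety ν R xbar) (homothetyVelocity R xbar))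
    (he : ∀ t ∈ Ioo (0 : ℝ) 1,
      R t ^ (2 * d) * homothetyEnergy ρ R xbar t = (4 * A * ρ ^ 2 / (d + 4)) ^ 2 / K ^ 2) :
    HasConstantK (movingHomothety ν R xbar) K := by
  refine ⟨hK, _, hv, ?_⟩
  rw [← Measure.restrict_congr_set Ioo_ae_eq_Icc, ae_restrict_iff' measurableSet_Ioo]
  exact .of_forall fun t ht =>
    (h.coefficientK_homothety_eq_iff (c.scale_pos t ht) .rfl hK).2 (he t ht)

end IsHomothetyPath

/-! ### Regular representatives on the moving ball. -/

/-- The region of space-time swept by the moving ball `B(x̄(t), R(t) ρ)`, `0 < t < 1`. -/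
def movingBall {d : ℕ} (ρ : ℝ) (R : ℝ → ℝ) (xbar : ℝ → EuclideanSpace ℝ (Fin d)) :
    Set (ℝ × EuclideanSpace ℝ (Fin d)) :=
  {p | p.1 ∈ Ioo (0 : ℝ) 1 ∧ ‖p.2 - xbar p.1‖ < R p.1 * ρ}

namespace IsParabolicProfile

variable {d : ℕ} {A ρ : ℝ} {ν : Measure (EuclideanSpace ℝ (Fin d))} {R : ℝ → ℝ}
  {xbar : ℝ → EuclideanSpace ℝ (Fin d)} {Ω : Set (EuclideanSpace ℝ (Fin d))} {t : ℝ}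

/-- The part of the ball outside the closed set Ω is open and the density is positive there; as μ_t
gives it no mass, it is empty. -/
theorem ball_subset_interior (h : IsParabolicProfile A ρ ν) (hΩ : IsClosed Ω) (hR : 0 < R t)
    (hμ : movingHomothety ν R xbar t Ωᶜ = 0) :
    Metric.ball (xbar t) (R t * ρ) ⊆ interior Ω := by
  refine interior_maximal (fun y hy => ?_) Metric.isOpen_ball
  by_contra hyΩ
  have hq := (continuous_homothetyDensity (d := d) A ρ R xbar t).measurable.ennreal_ofReal
  rw [h.homothety_eq_withDensity hR, withDensity_apply_eq_zero hq] at hμ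
  have hsub : Metric.ball (xbar t) (R t * ρ) ∩ Ωᶜ ⊆
      {x | ENNReal.ofReal (homothetyDensity A ρ R xbar t x) ≠ 0} ∩ Ωᶜ := by
    rintro x ⟨hx, hx'⟩
    refine ⟨?_, hx'⟩
    have := (h.homothetyDensity_pos_iff (xbar := xbar) hR).2 (mem_ball_iff_norm.1 hx)
    exact (ENNReal.ofReal_pos.2 this).ne'
  have hpos := (Metric.isOpen_ball.inter hΩ.isOpen_compl).measure_pos volume ⟨y, hy, hyΩ⟩
  exact hpos.ne' (measure_mono_null hsub hμ)

theorem homothety_eq_densityMeasure (h : IsParabolicProfile A ρ ν) (hΩ : IsClosed Ω)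
    (hR : 0 < R t) (hμ : movingHomothety ν R xbar t Ωᶜ = 0) :
    movingHomothety ν R xbar t = densityMeasure Ω (homothetyDensity A ρ R xbar t) := by
  have h1 : (movingHomothety ν R xbar t).restrict Ω = movingHomothety ν R xbar t :=
    Measure.restrict_eq_self_of_ae_mem hμ
  rw [densityMeasure, ← restrict_withDensity hΩ.measurableSet, ← h.homothety_eq_withDensity hR, h1]

/-- The two densities agree a.e. on Ω; continuity upgrades this on the interior, where Lebesgue
measure charges every nonempty open set. -/
theorem density_eqOn_interior (h : IsParabolicProfile A ρ ν) (hΩ : IsClosed Ω)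
    (hR : 0 < R t) (hμ : movingHomothety ν R xbar t Ωᶜ = 0)
    {f : EuclideanSpace ℝ (Fin d) → ℝ} (hf : ContinuousOn f Ω) (hf0 : ∀ x ∈ Ω, 0 ≤ f x)
    (hμf : movingHomothety ν R xbar t = densityMeasure Ω f) :
    EqOn f (homothetyDensity A ρ R xbar t) (interior Ω) := by
  have hq := (continuous_homothetyDensity (d := d) A ρ R xbar t)
  have hprob := h.isProbabilityMeasure_homothety R xbar t
  have hfin : ∫⁻ x in Ω, ENNReal.ofReal (f x) ≠ ∞ := by
    have : (densityMeasure Ω f) univ ≠ ∞ := by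
      rw [← hμf]
      exact measure_ne_top _ _
    rwa [densityMeasure, withDensity_apply _ MeasurableSet.univ, Measure.restrict_univ] at this
  rw [h.homothety_eq_densityMeasure hΩ hR hμ, densityMeasure, densityMeasure, eq_comm,
    withDensity_eq_iff (hf.aemeasurable hΩ.measurableSet).ennreal_ofReal
      hq.measurable.ennreal_ofReal.aemeasurable hfin] at hμf
  have hae : f =ᵐ[volume.restrict Ω] homothetyDensity A ρ R xbar t := by
    filter_upwards [hμf, ae_restrict_mem hΩ.measurableSet] with x hx hxΩ
    exact (ENNReal.ofReal_eq_ofReal_iff (hf0 x hxΩ) (h.homothetyDensity_nonneg hR x)).1 hx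
  exact Measure.eqOn_open_of_ae_eq (ae_restrict_of_ae_restrict_of_subset interior_subset hae)
    isOpen_interior (hf.mono interior_subset) hq.continuousOn

/-- A property that holds a.e. for `μ_t` holds a.e. for the Lebesgue measure on the ball. -/
theorem ae_restrict_ball (h : IsParabolicProfile A ρ ν) (hR : 0 < R t)
    {p : EuclideanSpace ℝ (Fin d) → Prop} (hp : ∀ᵐ x ∂(movingHomothety ν R xbar t), p x) :
    ∀ᵐ x ∂(volume.restrict (Metric.ball (xbar t) (R t * ρ))), p x := by
  have hq := (continuous_homothetyDensity (d := d) A ρ R xbar t).measurable.ennreal_ofReal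
  rw [h.homothety_eq_withDensity hR, ae_withDensity_iff hq] at hp
  rw [ae_restrict_iff' Metric.isOpen_ball.measurableSet]
  filter_upwards [hp] with x hx hxb
  exact hx (ENNReal.ofReal_pos.2
    ((h.homothetyDensity_pos_iff (xbar := xbar) hR).2 (mem_ball_iff_norm.1 hxb))).ne'

theorem ae_mem_ball (h : IsParabolicProfile A ρ ν) (hR : 0 < R t) :
    ∀ᵐ x ∂(movingHomothety ν R xbar t), ‖x - xbar t‖ < R t * ρ := by
  have hq := (continuous_homothetyDensity (d := d) A ρ R xbar t).measurable.ennreal_ofReal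
  rw [h.homothety_eq_withDensity hR, ae_withDensity_iff hq]
  refine .of_forall fun x hx => ?_
  rw [← h.homothetyDensity_pos_iff hR]
  exact ENNReal.ofReal_pos.1 (pos_iff_ne_zero.2 hx)

end IsParabolicProfile

namespace IsHomothetyPath

variable {d : ℕ} {A ρ : ℝ} {ν : Measure (EuclideanSpace ℝ (Fin d))} {R : ℝ → ℝ}
  {xbar : ℝ → EuclideanSpace ℝ (Fin d)} {Ω : Set (EuclideanSpace ℝ (Fin d))}

theorem isOpen_movingBall (c : IsHomothetyPath R xbar) (ρ : ℝ) :
    IsOpen (movingBall ρ R xbar) := by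
  have h1 := c.scale_contDiffOn.continuousOn
  have h2 := c.center_contDiffOn.continuousOn
  have lift : ∀ {F : Type} [TopologicalSpace F] {g : ℝ → F}, ContinuousOn g (Ioo 0 1) →
      ContinuousOn (fun p : ℝ × EuclideanSpace ℝ (Fin d) => g p.1) (Ioo 0 1 ×ˢ univ) := fun hg =>
    hg.comp continuousOn_fst fun p hp => hp.1
  have h3 : ContinuousOn (fun p : ℝ × EuclideanSpace ℝ (Fin d) =>
      R p.1 * ρ - ‖p.2 - xbar p.1‖) (Ioo 0 1 ×ˢ univ) :=
    ((lift h1).mul continuousOn_const).sub (continuousOn_snd.sub (lift h2)).norm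
  have h4 := h3.isOpen_inter_preimage (isOpen_Ioo.prod isOpen_univ) (isOpen_Ioi (a := (0 : ℝ)))
  convert h4 using 1
  ext p
  simp [movingBall]

theorem contDiffOn_homothetyVelocity (c : IsHomothetyPath R xbar) :
    ContDiffOn ℝ 1 (fun p : ℝ × EuclideanSpace ℝ (Fin d) => homothetyVelocity R xbar p.1 p.2)
      (Ioo 0 1 ×ˢ univ) := by
  have lift : ∀ {F : Type} [NormedAddCommGroup F] [NormedSpace ℝ F] {g : ℝ → F},
      ContDiffOn ℝ 1 g (Ioo 0 1) →
      ContDiffOn ℝ 1 (fun p : ℝ × EuclideanSpace ℝ (Fin d) => g p.1) (Ioo 0 1 ×ˢ univ) := fun hg =>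
    hg.comp contDiffOn_fst fun p hp => hp.1
  have h1 := lift (c.scale_contDiffOn.of_le one_le_two)
  have h2 := lift (c.center_contDiffOn.of_le one_le_two)
  have h3 := lift c.contDiffOn_deriv_scale
  have h4 := lift c.contDiffOn_deriv_center
  exact ((h3.div h1 fun p hp => (c.scale_pos p.1 hp.1).ne').smul (contDiffOn_snd.sub h2)).add h4

/-- Inside the moving ball the truncation, the only source of non-smoothness, is inactive. -/
theorem contDiffOn_homothetyDensity (c : IsHomothetyPath R xbar) (A ρ : ℝ) :
    ContDiffOn ℝ 1 (fun p : ℝ × EuclideanSpace ℝ (Fin d) => homothetyDensity A ρ R xbar p.1 p.2)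
      (movingBall ρ R xbar) := by
  have lift : ∀ {F : Type} [NormedAddCommGroup F] [NormedSpace ℝ F] {g : ℝ → F},
      ContDiffOn ℝ 1 g (Ioo 0 1) →
      ContDiffOn ℝ 1 (fun p : ℝ × EuclideanSpace ℝ (Fin d) => g p.1) (movingBall ρ R xbar) :=
    fun hg => hg.comp contDiffOn_fst fun p hp => hp.1
  have h1 := lift (c.scale_contDiffOn.of_le one_le_two)
  have h2 := lift (c.center_contDiffOn.of_le one_le_two)
  have hne : ∀ p ∈ movingBall ρ R xbar, R p.1 ≠ 0 := fun p hp => (c.scale_pos p.1 hp.1).ne'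
  have h3 : ContDiffOn ℝ 1 (fun p : ℝ × EuclideanSpace ℝ (Fin d) =>
      (R p.1 ^ d)⁻¹ * (A * (ρ ^ 2 - ‖(R p.1)⁻¹ • (p.2 - xbar p.1)‖ ^ 2))) (movingBall ρ R xbar) :=
    ((h1.pow d).inv fun p hp => pow_ne_zero _ (hne p hp)).mul (contDiffOn_const.mul
      (contDiffOn_const.sub (((h1.inv hne).smul (contDiffOn_snd.sub h2)).norm_sq ℝ)))
  refine h3.congr fun p hp => ?_
  have hR := c.scale_pos p.1 hp.1
  rw [homothetyDensity, parabolicDensity, max_eq_left]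
  rw [norm_smul, norm_inv, Real.norm_of_nonneg hR.le, sub_nonneg]
  refine pow_le_pow_left₀ (by positivity) ?_ 2
  rw [inv_mul_le_iff₀ hR]
  exact hp.2.le

theorem positivitySet_eq (c : IsHomothetyPath R xbar) (h : IsParabolicProfile A ρ ν)
    (hΩ : IsClosed Ω) (hμ : ∀ t ∈ Icc (0 : ℝ) 1, movingHomothety ν R xbar t Ωᶜ = 0)
    {u : ℝ → EuclideanSpace ℝ (Fin d) → ℝ}
    (hu : ∀ t ∈ Ioo (0 : ℝ) 1, EqOn (u t) (homothetyDensity A ρ R xbar t) (interior Ω)) :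
    positivitySet Ω u = movingBall ρ R xbar := by
  ext ⟨t, x⟩
  simp only [positivitySet, movingBall, mem_ofPred_eq]
  refine and_congr_right fun ht => ?_
  constructor
  · rintro ⟨hx, hpos⟩
    rwa [hu t ht hx, h.homothetyDensity_pos_iff (c.scale_pos t ht)] at hpos
  · intro hx
    have hxΩ := h.ball_subset_interior hΩ (c.scale_pos t ht) (hμ t (Ioo_subset_Icc_self ht))
      (mem_ball_iff_norm.2 hx)
    exact ⟨hxΩ, by rwa [hu t ht hxΩ, h.homothetyDensity_pos_iff (c.scale_pos t ht)]⟩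

/-- A continuous representative of a tangent field is the velocity of the flow. -/
theorem velocity_eqOn_movingBall (c : IsHomothetyPath R xbar) (h : IsParabolicProfile A ρ ν)
    {w : ℝ → EuclideanSpace ℝ (Fin d) → EuclideanSpace ℝ (Fin d)}
    (hw : IsTangentField (movingHomothety ν R xbar) w)
    (hwc : ContinuousOn (fun p : ℝ × EuclideanSpace ℝ (Fin d) => w p.1 p.2)
      (movingBall ρ R xbar)) {t : ℝ} {x : EuclideanSpace ℝ (Fin d)}
    (htx : (t, x) ∈ movingBall ρ R xbar) : w t x = homothetyVelocity R xbar t x := by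
  have hvc : ContinuousOn (fun p : ℝ × EuclideanSpace ℝ (Fin d) => homothetyVelocity R xbar p.1 p.2)
      (movingBall ρ R xbar) :=
    c.contDiffOn_homothetyVelocity.continuousOn.mono fun p hp => ⟨hp.1, mem_univ _⟩
  -- Two passes: for a.e. time, continuity in space gives equality on the whole ball; then, at fixed
  -- x, continuity in time removes the exceptional times.
  set U : Set ℝ := (fun s => (s, x)) ⁻¹' movingBall ρ R xbar with hU
  have hUo : IsOpen U := (c.isOpen_movingBall ρ).preimage (by fun_prop)
  have hUI : U ⊆ Icc 0 1 := fun s hs => Ioo_subset_Icc_self hs.1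
  have hae : (fun s => w s x) =ᵐ[volume.restrict U] fun s => homothetyVelocity R xbar s x := by
    filter_upwards [ae_restrict_of_ae_restrict_of_subset hUI (c.ae_eq_of_isTangentField h hw),
      ae_restrict_mem hUo.measurableSet] with s hs hsU
    refine Measure.eqOn_open_of_ae_eq (h.ae_restrict_ball (c.scale_pos s hsU.1) hs)
      Metric.isOpen_ball ?_ (continuous_homothetyVelocity R xbar s).continuousOn
      (mem_ball_iff_norm.2 hsU.2)
    exact hwc.comp (f := fun y => (s, y)) (by fun_prop) fun y hy =>
      ⟨hsU.1, mem_ball_iff_norm.1 hy⟩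
  exact Measure.eqOn_open_of_ae_eq (U := U) hae hUo
    (hwc.comp (f := fun s => (s, x)) (by fun_prop) fun s hs => hs)
    (hvc.comp (f := fun s => (s, x)) (by fun_prop) fun s hs => hs) htx

end IsHomothetyPath

/-! ### The momentum equation reduced to equations for R and x̄. -/

theorem gradient_homothetyDensity {d : ℕ} {A ρ : ℝ} {R : ℝ → ℝ}
    {xbar : ℝ → EuclideanSpace ℝ (Fin d)} {t : ℝ} (hR : 0 < R t) {x : EuclideanSpace ℝ (Fin d)}
    (hx : ‖x - xbar t‖ < R t * ρ) :
    gradient (homothetyDensity A ρ R xbar t) x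
      = -(2 * A / R t ^ (d + 2)) • (x - xbar t) := by
  have hev : homothetyDensity A ρ R xbar t =ᶠ[𝓝 x] fun y =>
      (R t ^ d)⁻¹ * (A * (ρ ^ 2 - (R t ^ 2)⁻¹ * ‖y - xbar t‖ ^ 2)) := by
    have hopen : IsOpen {y : EuclideanSpace ℝ (Fin d) | ‖y - xbar t‖ < R t * ρ} :=
      isOpen_lt (by fun_prop) (by fun_prop)
    filter_upwards [hopen.mem_nhds hx] with y hy
    have e : ‖(R t)⁻¹ • (y - xbar t)‖ ^ 2 = (R t ^ 2)⁻¹ * ‖y - xbar t‖ ^ 2 := by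
      rw [norm_smul, mul_pow, norm_inv, Real.norm_of_nonneg hR.le, inv_pow]
    rw [homothetyDensity, parabolicDensity, e, max_eq_left]
    rw [sub_nonneg, inv_mul_le_iff₀ (by positivity), ← mul_pow]
    exact pow_le_pow_left₀ (norm_nonneg _) (le_of_lt hy) 2
  rw [hev.gradient_eq]
  refine HasGradientAt.gradient ?_
  rw [hasGradientAt_iff_hasFDerivAt]
  have h1 : HasFDerivAt (fun y : EuclideanSpace ℝ (Fin d) => ‖y - xbar t‖ ^ 2)
      (2 • innerSL ℝ (x - xbar t)) x := by
    have := (hasStrictFDerivAt_norm_sq (x - xbar t)).hasFDerivAt.comp x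
      ((hasFDerivAt_id x).sub_const (xbar t))
    rwa [ContinuousLinearMap.comp_id] at this
  have h2 := (((h1.const_mul (R t ^ 2)⁻¹).const_sub (ρ ^ 2)).const_mul A).const_mul (R t ^ d)⁻¹
  have e : (InnerProductSpace.toDual ℝ (EuclideanSpace ℝ (Fin d)))
        (-(2 * A / R t ^ (d + 2)) • (x - xbar t))
      = (R t ^ d)⁻¹ • A • -((R t ^ 2)⁻¹ • 2 • innerSL ℝ (x - xbar t)) := by
    ext y
    simp only [InnerProductSpace.toDual_apply_apply, real_inner_smul_left, smul_apply, neg_apply,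
      innerSL_apply_apply, smul_eq_mul, nsmul_eq_mul]
    push_cast
    field_simp
    ring
  rw [e]
  exact h2

theorem fderiv_homothetyVelocity {d : ℕ} (R : ℝ → ℝ) (xbar : ℝ → EuclideanSpace ℝ (Fin d))
    (t : ℝ) (x y : EuclideanSpace ℝ (Fin d)) :
    fderiv ℝ (homothetyVelocity R xbar t) x y = (deriv R t / R t) • y := by
  have h : HasFDerivAt (homothetyVelocity R xbar t)
      ((deriv R t / R t) • ContinuousLinearMap.id ℝ (EuclideanSpace ℝ (Fin d))) x :=
    (((hasFDerivAt_id x).sub_const (xbar t)).const_smul (deriv R t / R t)).add_const _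
  rw [h.fderiv]
  simp

namespace IsHomothetyPath

variable {d : ℕ} {A ρ : ℝ} {ν : Measure (EuclideanSpace ℝ (Fin d))} {R : ℝ → ℝ}
  {xbar : ℝ → EuclideanSpace ℝ (Fin d)} {Ω : Set (EuclideanSpace ℝ (Fin d))} {t : ℝ}

theorem hasDerivAt_deriv_scale (c : IsHomothetyPath R xbar) (ht : t ∈ Ioo (0 : ℝ) 1) :
    HasDerivAt (deriv R) (deriv (deriv R) t) t :=
  hasDerivAt_of_contDiffOn isOpen_Ioo c.contDiffOn_deriv_scale (by norm_num) ht

theorem hasDerivAt_deriv_center (c : IsHomothetyPath R xbar) (ht : t ∈ Ioo (0 : ℝ) 1) :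
    HasDerivAt (deriv xbar) (deriv (deriv xbar) t) t :=
  hasDerivAt_of_contDiffOn isOpen_Ioo c.contDiffOn_deriv_center (by norm_num) ht

/-- The material derivative of the velocity of the flow. -/
theorem acceleration_homothetyVelocity (c : IsHomothetyPath R xbar) (ht : t ∈ Ioo (0 : ℝ) 1)
    (x : EuclideanSpace ℝ (Fin d)) :
    fderiv ℝ (homothetyVelocity R xbar t) x (homothetyVelocity R xbar t x)
        + deriv (fun s => homothetyVelocity R xbar s x) t
      = (deriv (deriv R) t / R t) • (x - xbar t) + deriv (deriv xbar) t := by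
  have hR := (c.scale_pos t ht).ne'
  have h1 := (c.hasDerivAt_deriv_scale ht).div (c.hasDerivAt_scale ht) hR
  have h2 := (h1.smul ((c.hasDerivAt_center ht).const_sub x)).add (c.hasDerivAt_deriv_center ht)
  have h3 : deriv (fun s => homothetyVelocity R xbar s x) t = _ := h2.deriv
  -- The convective terms (R'/R)²(x - x̄) and (R'/R) x̄' cancel against those from differentiating
  -- R'/R and x - x̄ in time.
  rw [fderiv_homothetyVelocity, h3, homothetyVelocity]
  simp only [Pi.div_apply]
  match_scalars <;> field_simp <;> ring

/-- The left-hand side of the momentum equation for the moving homothety. -/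
theorem momentum_eq (c : IsHomothetyPath R xbar) {x : EuclideanSpace ℝ (Fin d)}
    (htx : (t, x) ∈ movingBall ρ R xbar) (A S K : ℝ) :
    -(2 * S) • gradient (homothetyDensity A ρ R xbar t) x
        + K • (fderiv ℝ (homothetyVelocity R xbar t) x (homothetyVelocity R xbar t x)
          + deriv (fun s => homothetyVelocity R xbar s x) t)
      = ((R t)⁻¹ * (K * deriv (deriv R) t + 4 * A * S / R t ^ (d + 1))) • (x - xbar t)
        + K • deriv (deriv xbar) t := by
  have hR := c.scale_pos t htx.1
  rw [gradient_homothetyDensity hR htx.2, c.acceleration_homothetyVelocity htx.1]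
  match_scalars <;> field_simp <;> ring

/-- The momentum equation on the ball `B(x̄(t), R(t) ρ)` amounts to equations for `R` and `x̄`. -/
theorem momentum_iff (c : IsHomothetyPath R xbar) (hd : 0 < d) (hρ : 0 < ρ)
    (ht : t ∈ Ioo (0 : ℝ) 1) (A S : ℝ) {K : ℝ} (hK : K ≠ 0) :
    (∀ x, (t, x) ∈ movingBall ρ R xbar →
      -(2 * S) • gradient (homothetyDensity A ρ R xbar t) x
        + K • (fderiv ℝ (homothetyVelocity R xbar t) x (homothetyVelocity R xbar t x)
          + deriv (fun s => homothetyVelocity R xbar s x) t) = 0) ↔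
      deriv (deriv xbar) t = 0 ∧ K * deriv (deriv R) t + 4 * A * S / R t ^ (d + 1) = 0 := by
  have hR := c.scale_pos t ht
  constructor
  · intro h
    have hx : deriv (deriv xbar) t = 0 := by
      -- At the centre of the ball the term linear in x - x̄ disappears, which isolates x̄''.
      have hc : (t, xbar t) ∈ movingBall ρ R xbar :=
        ⟨ht, by simpa using mul_pos hR hρ⟩
      have := h _ hc
      rw [c.momentum_eq hc, sub_self, smul_zero, zero_add] at this
      exact (smul_eq_zero.1 this).resolve_left hK
    refine ⟨hx, ?_⟩
    have : Nontrivial (EuclideanSpace ℝ (Fin d)) := by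
      have : Nonempty (Fin d) := ⟨⟨0, hd⟩⟩
      infer_instance
    -- Any off-centre point of the ball isolates the coefficient of x - x̄; distance Rρ/2 keeps it
    -- inside.
    obtain ⟨e, he⟩ := exists_norm_eq (EuclideanSpace ℝ (Fin d)) (c := R t * ρ / 2) (by positivity)
    have hc : (t, xbar t + e) ∈ movingBall ρ R xbar := by
      refine ⟨ht, ?_⟩
      rw [add_sub_cancel_left, he]
      exact half_lt_self (by positivity)
    have h2 := h _ hc
    rw [c.momentum_eq hc, hx, smul_zero, add_zero, add_sub_cancel_left] at h2
    have he0 : e ≠ 0 := by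
      rw [← norm_ne_zero_iff, he]
      positivity
    have h3 := (smul_eq_zero.1 h2).resolve_right he0
    exact (mul_eq_zero.1 h3).resolve_left (inv_ne_zero hR.ne')
  · rintro ⟨h1, h2⟩ x hx
    rw [c.momentum_eq hx, h1, h2]
    simp

/-- If `R^{2d} V` is constant and `x̄'' = 0`, then a strictly concave `R` solves the second order
equation in the momentum equation. -/
theorem deriv_deriv_scale_of_strictConcaveOn (c : IsHomothetyPath R xbar)
    (h : IsParabolicProfile A ρ ν) {K : ℝ} (hK : 0 < K)
    (he : ∀ t ∈ Ioo (0 : ℝ) 1,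
      R t ^ (2 * d) * homothetyEnergy ρ R xbar t = (4 * A * ρ ^ 2 / (d + 4)) ^ 2 / K ^ 2)
    (hx : ∀ t ∈ Ioo (0 : ℝ) 1, deriv (deriv xbar) t = 0) (hR : StrictConcaveOn ℝ (Icc 0 1) R)
    (ht : t ∈ Ioo (0 : ℝ) 1) :
    K * deriv (deriv R) t + 4 * A * √(homothetyEnergy ρ R xbar t) / R t ^ (d + 1) = 0 := by
  have hd := h.dim_pos
  have hρ := h.radius_pos
  have hA := h.amplitude_pos
  have hd' : (0 : ℝ) < d := by exact_mod_cast hd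
  set m : ℝ := d * ρ ^ 2 / (d + 4) with hm
  have hm0 : 0 < m := by positivity
  set E : ℝ → ℝ := homothetyEnergy ρ R xbar with hE
  have hEderiv : ∀ s ∈ Ioo (0 : ℝ) 1, HasDerivAt E (2 * m * deriv R s * deriv (deriv R) s) s := by
    intro s hs
    have h1 := ((c.hasDerivAt_deriv_scale hs).pow 2).mul_const m
    have h2 := (c.hasDerivAt_deriv_center hs).norm_sq
    rw [hx s hs, inner_zero_right, mul_zero] at h2
    have h3 := h1.add h2
    refine h3.congr_deriv ?_
    push_cast
    ring
  -- The derivative of the conserved R²ᵈ V, with the factor 2 R²ᵈ⁻¹ cancelled.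
  have hprod : ∀ s ∈ Ioo (0 : ℝ) 1,
      deriv R s * (d * E s + m * R s * deriv (deriv R) s) = 0 := by
    intro s hs
    have hRs := c.scale_pos s hs
    have h1 := ((c.hasDerivAt_scale hs).pow (2 * d)).mul (hEderiv s hs)
    have h2 : HasDerivAt (fun s => R s ^ (2 * d) * E s) 0 s := by
      refine (hasDerivAt_const s ((4 * A * ρ ^ 2 / ((d : ℝ) + 4)) ^ 2 / K ^ 2)).congr_of_eventuallyEq
        ?_
      filter_upwards [Ioo_mem_nhds hs.1 hs.2] with r hr
      exact he r hr
    have h3 := h1.unique h2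
    obtain ⟨n, hn⟩ : ∃ n, 2 * d = n + 1 := ⟨2 * d - 1, by omega⟩
    have hn' : (d : ℝ) = (n + 1) / 2 := by
      have : (2 : ℝ) * d = n + 1 := by exact_mod_cast hn
      linarith
    rw [hn] at h3
    simp only [Nat.add_sub_cancel, Pi.pow_apply] at h3
    push_cast at h3
    have h4 : R s ^ n * (deriv R s * (d * E s + m * R s * deriv (deriv R) s)) = 0 := by
      rw [hn']
      linear_combination h3 / 2
    exact (mul_eq_zero.1 h4).resolve_left (by positivity)
  have hanti : StrictAntiOn (deriv R) (Ioo 0 1) :=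
    (hR.subset Ioo_subset_Icc_self (convex_Ioo 0 1)).strictAntiOn_deriv fun s hs =>
      (c.hasDerivAt_scale hs).differentiableAt
  have hae : (fun s => d * E s + m * R s * deriv (deriv R) s)
      =ᵐ[volume.restrict (Ioo 0 1)] fun _ => 0 := by
    -- R' is strictly decreasing, so it has at most one zero; away from it the factor R' cancels,
    -- and continuity recovers the missing time.
    have hsub : {s | s ∈ Ioo (0 : ℝ) 1 ∧ deriv R s = 0}.Subsingleton := fun a ha b hb =>
      hanti.injOn ha.1 hb.1 (ha.2.trans hb.2.symm)
    have hnull := hsub.measure_zero volume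
    filter_upwards [ae_restrict_mem measurableSet_Ioo,
      ae_restrict_of_ae (compl_mem_ae_iff.2 hnull)] with s hs hs'
    have hne : deriv R s ≠ 0 := fun h0 => hs' ⟨hs, h0⟩
    exact (mul_eq_zero.1 (hprod s hs)).resolve_left hne
  have hcont : ContinuousOn (fun s => d * E s + m * R s * deriv (deriv R) s) (Ioo 0 1) := by
    have h1 : ContinuousOn E (Ioo 0 1) := fun s hs => (hEderiv s hs).continuousAt.continuousWithinAt
    have h2 := c.scale_contDiffOn.continuousOn
    have h3 := c.contDiffOn_deriv_scale.continuousOn_deriv_of_isOpen isOpen_Ioo le_rfl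
    fun_prop
  have hode := Measure.eqOn_open_of_ae_eq hae isOpen_Ioo hcont continuousOn_const ht
  simp only at hode
  have hRt := c.scale_pos t ht
  have hEt : 0 ≤ E t := homothetyEnergy_nonneg ρ R xbar t
  have hsq : √(E t) ^ 2 = E t := Real.sq_sqrt hEt
  -- The positive square root of the conservation law, which is F = K√V; it brings in K and A.
  have hroot : R t ^ d * √(E t) * K = 4 * A * ρ ^ 2 / (d + 4) := by
    have h1 := he t ht
    rw [← div_pow] at h1
    have h2 : (R t ^ d * √(E t)) ^ 2 = R t ^ (2 * d) * E t := by
      rw [mul_pow, hsq, ← pow_mul, mul_comm d 2]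
    rw [← h2, sq_eq_sq₀ (by positivity) (by positivity), eq_div_iff hK.ne'] at h1
    exact h1
  have hroot' : R t ^ d * √(E t) * K * (d + 4) = 4 * A * ρ ^ 2 := by
    rw [hroot]
    field_simp
  have hode' : (d + 4) * √(E t) ^ 2 + ρ ^ 2 * R t * deriv (deriv R) t = 0 := by
    rw [hsq]
    have : d * ((d + 4) * E t + ρ ^ 2 * R t * deriv (deriv R) t) = 0 := by
      rw [hm] at hode
      field_simp at hode
      linarith
    exact (mul_eq_zero.1 this).resolve_left hd'.ne'
  have hfin : ρ ^ 2 * (K * deriv (deriv R) t * R t ^ (d + 1) + 4 * A * √(E t)) = 0 := by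
    linear_combination K * R t ^ d * hode' - √(E t) * hroot'
  have := (mul_eq_zero.1 hfin).resolve_left (by positivity)
  field_simp
  linarith

end IsHomothetyPath

/-! ### Integrability up to the end points and existence of a velocity field. -/

/-- The derivative may be unbounded at 0 and at 1, but f' minus its value at 1/2 has a constant sign
on each half. A one-signed derivative of a function continuous up to the end points is integrable.
-/
theorem intervalIntegrable_deriv_of_antitoneOn {f f' : ℝ → ℝ} (hf : ContinuousOn f (Icc 0 1))
    (hd : ∀ t ∈ Ioo (0 : ℝ) 1, HasDerivAt f (f' t) t) (hanti : AntitoneOn f' (Ioo 0 1)) :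
    IntervalIntegrable f' volume 0 1 := by
  have hmid : (1 / 2 : ℝ) ∈ Ioo (0 : ℝ) 1 := by norm_num
  set k := f' (1 / 2)
  have left : IntervalIntegrable f' volume 0 (1 / 2) := by
    have h1 : IntegrableOn (fun t => f' t - k) (Ioc 0 (1 / 2)) := by
      refine intervalIntegral.integrableOn_deriv_of_nonneg (g := fun t => f t - k * t)
        ((hf.mono (Icc_subset_Icc_right (by norm_num))).sub (by fun_prop)) (fun t ht => ?_)
        (fun t ht => ?_)
      · have ht' : t ∈ Ioo (0 : ℝ) 1 := ⟨ht.1, by linarith [ht.2]⟩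
        exact ((hd t ht').sub ((hasDerivAt_id t).const_mul k)).congr_deriv (by rw [mul_one])
      · exact sub_nonneg.2 (hanti ⟨ht.1, by linarith [ht.2]⟩ hmid ht.2.le)
    have h2 := ((intervalIntegrable_iff_integrableOn_Ioc_of_le (by norm_num)).2 h1).add
      (intervalIntegrable_const (c := k))
    exact h2.congr fun t _ => by simp
  have right : IntervalIntegrable f' volume (1 / 2) 1 := by
    have h1 : IntegrableOn (fun t => k - f' t) (Ioc (1 / 2) 1) := by
      refine intervalIntegral.integrableOn_deriv_of_nonneg (g := fun t => k * t - f t)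
        (ContinuousOn.sub (by fun_prop) (hf.mono (Icc_subset_Icc_left (by norm_num))))
        (fun t ht => ?_) (fun t ht => ?_)
      · have ht' : t ∈ Ioo (0 : ℝ) 1 := ⟨by linarith [ht.1], ht.2⟩
        exact (((hasDerivAt_id t).const_mul k).sub (hd t ht')).congr_deriv (by rw [mul_one])
      · exact sub_nonneg.2 (hanti hmid ⟨by linarith [ht.1], ht.2⟩ ht.1.le)
    have h2 := (intervalIntegrable_const (c := k)).sub
      ((intervalIntegrable_iff_integrableOn_Ioc_of_le (by norm_num)).2 h1)
    exact h2.congr fun t _ => by simp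
  exact left.trans right

/-- A continuous function on `[0,1]` with vanishing second derivative is affine. -/
theorem eq_affine_of_deriv_deriv_eq_zero {F : Type*} [NormedAddCommGroup F] [NormedSpace ℝ F]
    {f : ℝ → F} (hf : ContinuousOn f (Icc 0 1)) (hf2 : ContDiffOn ℝ 2 f (Ioo 0 1))
    (h : ∀ t ∈ Ioo (0 : ℝ) 1, deriv (deriv f) t = 0) {t : ℝ} (ht : t ∈ Icc (0 : ℝ) 1) :
    f t = (1 - t) • f 0 + t • f 1 := by
  have hd1 : DifferentiableOn ℝ (deriv f) (Ioo 0 1) :=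
    (contDiffOn_deriv_of_two isOpen_Ioo hf2).differentiableOn one_ne_zero
  obtain ⟨w, hw⟩ := isOpen_Ioo.exists_is_const_of_deriv_eq_zero isPreconnected_Ioo hd1 h
  have hd2 : DifferentiableOn ℝ (fun s => f s - s • w) (Ioo 0 1) :=
    (hf2.differentiableOn two_ne_zero).sub (by fun_prop)
  have hd3 : EqOn (deriv fun s => f s - s • w) 0 (Ioo 0 1) := fun s hs => by
    have h1 := (hasDerivAt_of_contDiffOn isOpen_Ioo hf2 two_ne_zero hs).sub
      ((hasDerivAt_id s).smul_const w)
    have h2 : deriv (fun s => f s - s • w) s = _ := h1.deriv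
    rw [h2, hw s hs]
    simp
  obtain ⟨k, hk⟩ := isOpen_Ioo.exists_is_const_of_deriv_eq_zero isPreconnected_Ioo hd2 hd3
  have hcl : EqOn (fun s => f s - s • w) (fun _ => k) (Icc 0 1) :=
    EqOn.of_subset_closure (s := Ioo 0 1) hk (hf.sub (by fun_prop)) continuousOn_const
      Ioo_subset_Icc_self (by rw [closure_Ioo zero_ne_one])
  have h0 := hcl (left_mem_Icc.2 zero_le_one)
  have h1 := hcl (right_mem_Icc.2 zero_le_one)
  have h2 := hcl ht
  simp only [zero_smul, sub_zero, one_smul] at h0 h1 h2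
  rw [sub_eq_iff_eq_add] at h1 h2
  rw [h2, h1, h0]
  module

namespace IsHomothetyPath

variable {d : ℕ} {A ρ : ℝ} {ν : Measure (EuclideanSpace ℝ (Fin d))} {R : ℝ → ℝ}
  {xbar : ℝ → EuclideanSpace ℝ (Fin d)} {Ω : Set (EuclideanSpace ℝ (Fin d))}

/-- The derivative of ∫ φ dμ_t is dominated by a multiple of |R'|ρ + |x̄'|, so the fundamental
theorem of calculus holds up to the end points. -/
theorem isVelocityField_of_intervalIntegrable (c : IsHomothetyPath R xbar)
    (h : IsParabolicProfile A ρ ν) (hR : IntervalIntegrable (deriv R) volume 0 1)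
    (hx : IntervalIntegrable (deriv xbar) volume 0 1) :
    IsVelocityField (movingHomothety ν R xbar) (homothetyVelocity R xbar) := by
  refine ⟨.of_forall fun t => memLp_homothetyVelocity h R xbar t, ?_⟩
  intro φ hφ _ t₁ ht₁ t₂ ht₂ h12
  set f : ℝ → ℝ := fun t => ∫ x, φ x ∂(movingHomothety ν R xbar t)
  set g : ℝ → ℝ := fun s => ∫ x, inner ℝ (gradient φ x) (homothetyVelocity R xbar s x)
    ∂(movingHomothety ν R xbar s) with hg
  have hfg : ∀ t ∈ Ioo (0 : ℝ) 1, HasDerivAt f (g t) t := fun t ht => c.hasDerivAt_integral h hφ ht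
  obtain ⟨M, hM, hsupp⟩ := c.exists_bound h
  obtain ⟨C, hC⟩ := (isCompact_closedBall (0 : EuclideanSpace ℝ (Fin d)) M)
    |>.exists_bound_of_continuousOn (continuous_gradient hφ).continuousOn
  have hC0 : 0 ≤ C := (norm_nonneg _).trans (hC 0 (by simpa using hM.le))
  have hbound : ∀ t ∈ Ioo (0 : ℝ) 1, ‖g t‖ ≤ C * (‖deriv R t‖ * ρ + ‖deriv xbar t‖) := by
    intro t ht
    have hRt := c.scale_pos t ht
    have := h.isProbabilityMeasure_homothety R xbar t
    have key : ∀ᵐ x ∂(movingHomothety ν R xbar t),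
        ‖(inner ℝ (gradient φ x) (homothetyVelocity R xbar t x) : ℝ)‖
          ≤ C * (‖deriv R t‖ * ρ + ‖deriv xbar t‖) := by
      filter_upwards [hsupp t (Ioo_subset_Icc_self ht), h.ae_mem_ball hRt] with x h1 h2
      refine (norm_inner_le_norm _ _).trans (mul_le_mul (hC x (by simpa using h1.le)) ?_
        (norm_nonneg _) hC0)
      refine (norm_add_le _ _).trans (add_le_add_left ?_ _)
      rw [norm_smul, norm_div, Real.norm_of_nonneg hRt.le, div_mul_eq_mul_div, div_le_iff₀ hRt]
      calc ‖deriv R t‖ * ‖x - xbar t‖ ≤ ‖deriv R t‖ * (R t * ρ) := by gcongr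
        _ = ‖deriv R t‖ * ρ * R t := by ring
    exact (norm_integral_le_of_norm_le_const key).trans_eq (by simp)
  have hint : IntervalIntegrable g volume 0 1 := by
    have hdom := ((hR.norm.mul_const ρ).add hx.norm).const_mul C
    rw [intervalIntegrable_iff_integrableOn_Ioo_of_le zero_le_one] at hdom ⊢
    refine Integrable.mono' hdom ?_ ?_
    -- Measurability in time follows because `g` agrees on (0,1) with a derivative, and `deriv f` is
    -- always measurable.
    · refine (measurable_deriv f).aestronglyMeasurable.congr ?_
      filter_upwards [ae_restrict_mem measurableSet_Ioo] with t ht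
      exact (hfg t ht).deriv
    · filter_upwards [ae_restrict_mem measurableSet_Ioo] with t ht
      exact hbound t ht
  have hint' : IntervalIntegrable g volume t₁ t₂ := hint.mono_set (by
    rw [uIcc_of_le h12.le, uIcc_of_le zero_le_one]
    exact Icc_subset_Icc ht₁.1 ht₂.2)
  refine ⟨hint', ?_⟩
  exact (intervalIntegral.integral_eq_sub_of_hasDerivAt_of_le h12.le
    ((c.continuousOn_integral h hφ.continuous).mono (Icc_subset_Icc ht₁.1 ht₂.2))
    (fun t ht => hfg t (Ioo_subset_Ioo ht₁.1 ht₂.2 ht)) hint').symm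

/-! ### Equivalence of the system with the equations of motion. -/

theorem kineticV_congr {μ μ' : ℝ → Measure (EuclideanSpace ℝ (Fin d))} {t : ℝ} (h : μ t = μ' t)
    (v : ℝ → EuclideanSpace ℝ (Fin d) → EuclideanSpace ℝ (Fin d)) :
    kineticV μ v t = kineticV μ' v t := by
  rw [kineticV, kineticV, h]

/-- The equations of motion of a moving homothety that solves the system. -/
theorem equations_of_curveSolvesSystem (c : IsHomothetyPath R xbar)
    (h : IsParabolicProfile A ρ ν) (hΩ : IsClosed Ω)
    (hμ : ∀ t ∈ Icc (0 : ℝ) 1, movingHomothety ν R xbar t Ωᶜ = 0) {K : ℝ} (hK : K ≠ 0)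
    (hsol : CurveSolvesSystem Ω (movingHomothety ν R xbar) K) {t : ℝ} (ht : t ∈ Ioo (0 : ℝ) 1) :
    deriv (deriv xbar) t = 0 ∧
      K * deriv (deriv R) t + 4 * A * √(homothetyEnergy ρ R xbar t) / R t ^ (d + 1) = 0 := by
  obtain ⟨u, v, huμ, hv, hs⟩ := hsol
  have hu : ∀ t ∈ Ioo (0 : ℝ) 1, EqOn (u t) (homothetyDensity A ρ R xbar t) (interior Ω) :=
    fun s hsI => h.density_eqOn_interior hΩ (c.scale_pos s hsI) (hμ s (Ioo_subset_Icc_self hsI))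
      (hs.continuousOn_density.comp (f := fun x => (s, x)) (by fun_prop) fun x hx => ⟨hsI, hx⟩)
      (hs.nonneg s hsI) (huμ s hsI)
  have hP := c.positivitySet_eq h hΩ hμ hu
  have hvc := hs.contDiffOn_velocity.continuousOn
  rw [hP] at hvc
  have hveq : ∀ {s x}, (s, x) ∈ movingBall ρ R xbar → v s x = homothetyVelocity R xbar s x :=
    fun hsx => c.velocity_eqOn_movingBall h hv hvc hsx
  have hopen := c.isOpen_movingBall ρ
  have hRt := c.scale_pos t ht
  have hkin : kineticV (fun s => densityMeasure Ω (u s)) v t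
      = ENNReal.ofReal (homothetyEnergy ρ R xbar t) := by
    rw [kineticV_congr (μ' := movingHomothety ν R xbar) (huμ t ht).symm]
    refine h.kineticV_homothety hRt ?_
    filter_upwards [h.ae_mem_ball (xbar := xbar) hRt] with x hx
    exact hveq ⟨ht, hx⟩
  rw [← c.momentum_iff h.dim_pos h.radius_pos ht A (√(homothetyEnergy ρ R xbar t)) hK]
  intro x hx
  have hmom := hs.momentum t x (by rwa [hP])
  -- Openness of the moving ball makes the representatives agree near x at fixed t and near t at
  -- fixed x, so all derivatives in the momentum equation transfer.
  have hslice : {y | (t, y) ∈ movingBall ρ R xbar} ∈ 𝓝 x :=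
    (hopen.preimage (f := fun y => (t, y)) (by fun_prop)).mem_nhds hx
  have htime : {s | (s, x) ∈ movingBall ρ R xbar} ∈ 𝓝 t :=
    (hopen.preimage (f := fun s => (s, x)) (by fun_prop)).mem_nhds hx
  have e1 : u t =ᶠ[𝓝 x] homothetyDensity A ρ R xbar t := by
    filter_upwards [hslice] with y hy
    exact hu t ht (h.ball_subset_interior hΩ hRt (hμ t (Ioo_subset_Icc_self ht))
      (mem_ball_iff_norm.2 hy.2))
  have e2 : v t =ᶠ[𝓝 x] homothetyVelocity R xbar t := by
    filter_upwards [hslice] with y hy using hveq hy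
  have e3 : (fun s => v s x) =ᶠ[𝓝 t] fun s => homothetyVelocity R xbar s x := by
    filter_upwards [htime] with s hs using hveq hs
  rwa [hkin, ENNReal.toReal_ofReal (homothetyEnergy_nonneg ρ R xbar t), e1.gradient_eq,
    e2.fderiv_eq, e3.deriv_eq, hveq hx] at hmom

/-- The explicit density and flow velocity serve as representatives; only the momentum equation and
the value of K use the equations assumed here. -/
theorem curveSolvesSystem_of_equations (c : IsHomothetyPath R xbar)
    (h : IsParabolicProfile A ρ ν) (hΩ : IsClosed Ω)
    (hμ : ∀ t ∈ Icc (0 : ℝ) 1, movingHomothety ν R xbar t Ωᶜ = 0) {K : ℝ} (hK : 0 < K)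
    (hv : IsTangentField (movingHomothety ν R xbar) (homothetyVelocity R xbar))
    (he : ∀ t ∈ Ioo (0 : ℝ) 1,
      R t ^ (2 * d) * homothetyEnergy ρ R xbar t = (4 * A * ρ ^ 2 / (d + 4)) ^ 2 / K ^ 2)
    (hmot : ∀ t ∈ Ioo (0 : ℝ) 1, deriv (deriv xbar) t = 0 ∧
      K * deriv (deriv R) t + 4 * A * √(homothetyEnergy ρ R xbar t) / R t ^ (d + 1) = 0) :
    CurveSolvesSystem Ω (movingHomothety ν R xbar) K := by
  have hμt : ∀ t ∈ Ioo (0 : ℝ) 1,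
      movingHomothety ν R xbar t = densityMeasure Ω (homothetyDensity A ρ R xbar t) := fun t ht =>
    h.homothety_eq_densityMeasure hΩ (c.scale_pos t ht) (hμ t (Ioo_subset_Icc_self ht))
  have hP : positivitySet Ω (homothetyDensity A ρ R xbar) = movingBall ρ R xbar :=
    c.positivitySet_eq h hΩ hμ fun t _ => eqOn_refl _ _
  have hweak : ∀ (f : BoundedContinuousFunction (EuclideanSpace ℝ (Fin d)) ℝ) (l : Filter ℝ)
      (t₀ : ℝ), t₀ ∈ Icc (0 : ℝ) 1 → 𝓝[Ioo 0 1] t₀ = l →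
      Tendsto (fun t => ∫ x, f x ∂(densityMeasure Ω (homothetyDensity A ρ R xbar t))) l
        (𝓝 (∫ x, f x ∂(movingHomothety ν R xbar t₀))) := by
    rintro f l t₀ ht₀ rfl
    have h1 := (c.continuousOn_integral h f.continuous t₀ ht₀).tendsto.mono_left
      (nhdsWithin_mono t₀ Ioo_subset_Icc_self)
    refine h1.congr' ?_
    filter_upwards [self_mem_nhdsWithin] with t ht
    rw [hμt t ht]
  refine ⟨homothetyDensity A ρ R xbar, homothetyVelocity R xbar, hμt, hv, ?_⟩
  constructor
  · exact fun t ht x _ => h.homothetyDensity_nonneg (c.scale_pos t ht) x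
  · have lift : ∀ {F : Type} [TopologicalSpace F] {g : ℝ → F}, ContinuousOn g (Ioo 0 1) →
        ContinuousOn (fun p : ℝ × EuclideanSpace ℝ (Fin d) => g p.1) (Ioo 0 1 ×ˢ Ω) := fun hg =>
      hg.comp continuousOn_fst fun p hp => hp.1
    have h1 := lift c.scale_contDiffOn.continuousOn
    have h2 := lift c.center_contDiffOn.continuousOn
    have hne : ∀ p ∈ Ioo (0 : ℝ) 1 ×ˢ Ω, R p.1 ≠ 0 := fun p hp => (c.scale_pos p.1 hp.1).ne'
    exact ((h1.pow d).inv₀ fun p hp => pow_ne_zero _ (hne p hp)).mul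
      ((continuous_parabolicDensity A ρ).comp_continuousOn
        ((h1.inv₀ hne).smul (continuousOn_snd.sub h2)))
  · rw [hP]
    exact c.contDiffOn_homothetyDensity A ρ
  · rw [hP]
    exact c.contDiffOn_homothetyVelocity.mono fun p hp => ⟨hp.1, mem_univ _⟩
  · intro t ht
    have h1 := (h.coefficientK_homothety_eq_iff (c.scale_pos t ht) .rfl hK).2 (he t ht)
    rw [← h1, coefficientK, coefficientK, kineticV, kineticV, hμt t ht]
  · intro t x hx
    rw [hP] at hx
    have ht := hx.1
    rw [kineticV_congr (μ' := movingHomothety ν R xbar) (hμt t ht).symm,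
      h.kineticV_homothety (c.scale_pos t ht) .rfl,
      ENNReal.toReal_ofReal (homothetyEnergy_nonneg ρ R xbar t)]
    exact (c.momentum_iff h.dim_pos h.radius_pos ht A _ hK.ne').2 (hmot t ht) x hx
  · intro φ hφ hφc t₁ ht₁ t₂ ht₂ h12
    have key := hv.1.2 φ hφ hφc t₁ (Ioo_subset_Icc_self ht₁) t₂ (Ioo_subset_Icc_self ht₂) h12
    have hcongr : EqOn
        (fun s => ∫ x, inner ℝ (gradient φ x) (homothetyVelocity R xbar s x)
          ∂(movingHomothety ν R xbar s))
        (fun s => ∫ x, inner ℝ (gradient φ x) (homothetyVelocity R xbar s x)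
          ∂(densityMeasure Ω (homothetyDensity A ρ R xbar s))) (uIcc t₁ t₂) := fun s hs => by
      rw [uIcc_of_le h12.le] at hs
      simp only [hμt s ⟨ht₁.1.trans_le hs.1, hs.2.trans_lt ht₂.2⟩]
    beta_reduce
    rw [← hμt t₁ ht₁, ← hμt t₂ ht₂, ← intervalIntegral.integral_congr hcongr]
    exact ⟨key.1.congr fun s hs => hcongr (uIoc_subset_uIcc hs), key.2⟩
  · intro t ht x hx n _
    have hRt := c.scale_pos t ht
    -- The open ball where u > 0 lies in the interior of Ω, so u vanishes on the frontier and the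
    -- flux condition holds for every normal.
    have hx0 : homothetyDensity A ρ R xbar t x = 0 := by
      refine le_antisymm (not_lt.1 fun hpos => ?_) (h.homothetyDensity_nonneg hRt x)
      rw [h.homothetyDensity_pos_iff hRt] at hpos
      exact hx.2 (h.ball_subset_interior hΩ hRt (hμ t (Ioo_subset_Icc_self ht))
        (mem_ball_iff_norm.2 hpos))
    rw [hx0, zero_mul]
  · exact fun f => hweak f _ 0 (by simp) (nhdsWithin_Ioo_eq_nhdsGT one_pos)
  · exact fun f => hweak f _ 1 (by simp) (nhdsWithin_Ioo_eq_nhdsLT one_pos)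

/-- With constant `K`, the system holds iff the centre moves along a segment at constant speed and
the scale is strictly concave. -/
theorem curveSolvesSystem_iff (c : IsHomothetyPath R xbar)
    (h : IsParabolicProfile A ρ ν) (hΩ : IsClosed Ω)
    (hμ : ∀ t ∈ Icc (0 : ℝ) 1, movingHomothety ν R xbar t Ωᶜ = 0) {K : ℝ}
    (hK : HasConstantK (movingHomothety ν R xbar) K) :
    CurveSolvesSystem Ω (movingHomothety ν R xbar) K ↔
      (∀ t ∈ Ioo (0 : ℝ) 1, deriv (deriv xbar) t = 0) ∧ StrictConcaveOn ℝ (Icc 0 1) R := by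
  have he := fun t (ht : t ∈ Ioo (0 : ℝ) 1) => c.energy_eq_of_hasConstantK h hK ht
  have hK0 := hK.1
  have hA := h.amplitude_pos
  have hρ := h.radius_pos
  constructor
  · intro hsol
    have heq := fun t (ht : t ∈ Ioo (0 : ℝ) 1) =>
      c.equations_of_curveSolvesSystem h hΩ hμ hK0.ne' hsol ht
    refine ⟨fun t ht => (heq t ht).1, strictConcaveOn_of_deriv2_neg (convex_Icc 0 1)
      c.scale_continuousOn fun t ht => ?_⟩
    rw [interior_Icc] at ht
    have hRt := c.scale_pos t ht
    -- V cannot vanish, because R²ᵈ V equals a positive constant; this is what makes R'' strictly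
    -- negative.
    have hV : 0 < homothetyEnergy ρ R xbar t := by
      have h1 : 0 < R t ^ (2 * d) * homothetyEnergy ρ R xbar t := by
        rw [he t ht]
        positivity
      exact pos_of_mul_pos_right h1 (by positivity)
    have h2 : 0 < 4 * A * √(homothetyEnergy ρ R xbar t) / R t ^ (d + 1) := by
      have := Real.sqrt_pos.2 hV
      positivity
    have h3 := (heq t ht).2
    have h4 : K * deriv (deriv R) t < 0 := by linarith
    exact (pos_iff_neg_of_mul_neg h4).1 hK0
  · rintro ⟨hx, hR⟩
    obtain ⟨w, hw, -⟩ := hK.2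
    exact c.curveSolvesSystem_of_equations h hΩ hμ hK0 (c.isTangentField_of_exists h hw.1) he
      fun t ht => ⟨hx t ht, c.deriv_deriv_scale_of_strictConcaveOn h hK0 he hx hR ht⟩

/-- Strict concavity is used twice: R' is not identically zero, so C > 0, and R' is monotone, hence
integrable, so the flow velocity is a velocity field. -/
theorem exists_hasConstantK (c : IsHomothetyPath R xbar) (h : IsParabolicProfile A ρ ν)
    (hx : ∀ t ∈ Ioo (0 : ℝ) 1, deriv (deriv xbar) t = 0) {C : ℝ}
    (hC : ∀ t ∈ Ioo (0 : ℝ) 1, R t ^ (2 * d) * homothetyEnergy ρ R xbar t = C)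
    (hR : StrictConcaveOn ℝ (Icc 0 1) R) :
    ∃ K : ℝ, HasConstantK (movingHomothety ν R xbar) K := by
  have hA := h.amplitude_pos
  have hρ := h.radius_pos
  have hd : (0 : ℝ) < d := by exact_mod_cast h.dim_pos
  have hanti : StrictAntiOn (deriv R) (Ioo 0 1) :=
    (hR.subset Ioo_subset_Icc_self (convex_Ioo 0 1)).strictAntiOn_deriv fun s hs =>
      (c.hasDerivAt_scale hs).differentiableAt
  have hC0 : 0 < C := by
    obtain ⟨t, ht, hne⟩ : ∃ t ∈ Ioo (0 : ℝ) 1, deriv R t ≠ 0 := by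
      by_contra! hcon
      have h1 : (1 / 3 : ℝ) ∈ Ioo (0 : ℝ) 1 := by norm_num
      have h2 : (1 / 2 : ℝ) ∈ Ioo (0 : ℝ) 1 := by norm_num
      have := hanti h1 h2 (by norm_num)
      rw [hcon _ h1, hcon _ h2] at this
      exact this.false
    rw [← hC t ht, homothetyEnergy]
    have := c.scale_pos t ht
    positivity
  have hRint : IntervalIntegrable (deriv R) volume 0 1 :=
    intervalIntegrable_deriv_of_antitoneOn c.scale_continuousOn
      (fun t ht => c.hasDerivAt_scale ht) hanti.antitoneOn
  have hxint : IntervalIntegrable (deriv xbar) volume 0 1 := by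
    obtain ⟨w, hw⟩ := isOpen_Ioo.exists_is_const_of_deriv_eq_zero isPreconnected_Ioo
      (c.contDiffOn_deriv_center.differentiableOn one_ne_zero) hx
    refine (intervalIntegrable_const (c := w)).congr_uIoo fun t ht => ?_
    rw [uIoo_of_le zero_le_one] at ht
    exact (hw t ht).symm
  have hv := c.isTangentField_of_exists h (c.isVelocityField_of_intervalIntegrable h hRint hxint)
  -- The solution K = F₀/√C of F₀²/K² = C.
  refine ⟨4 * A * ρ ^ 2 / (d + 4) / √C, c.hasConstantK_of_energy_eq h (by positivity) hv
    fun t ht => ?_⟩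
  have hs := Real.sq_sqrt hC0.le
  rw [hC t ht, div_pow (4 * A * ρ ^ 2 / ((d : ℝ) + 4)), hs, div_div_cancel₀ (by positivity)]

end IsHomothetyPath

end WassersteinConformal

end

/-! ### The theorem. -/

theorem mainTheorem6 (d : ℕ) (hd : 0 < d)
    (Ω : Set (EuclideanSpace ℝ (Fin d))) (hΩ_closed : IsClosed Ω) (hΩ_convex : Convex ℝ Ω)
    -- the reference measure
    (A ρ : ℝ) (hρ : 0 < ρ) (μbar : Measure (EuclideanSpace ℝ (Fin d)))
    (hμbar_prob : IsProbabilityMeasure μbar)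
    (hμbar : μbar = volume.withDensity
      fun x : EuclideanSpace ℝ (Fin d) => ENNReal.ofReal (A * max (ρ ^ 2 - ‖x‖ ^ 2) 0))
    (hμbar_Ω : μbar Ωᶜ = 0)
    -- the curve
    (a b : EuclideanSpace ℝ (Fin d)) (ha : a ∈ Ω) (hb : b ∈ Ω)
    (R : ℝ → ℝ) (xbar : ℝ → EuclideanSpace ℝ (Fin d))
    (hR_cont : ContinuousOn R (Icc 0 1)) (hR_smooth : ContDiffOn ℝ 2 R (Ioo 0 1))
    (hR_pos : ∀ t ∈ Ioo (0 : ℝ) 1, 0 < R t)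
    (hx_cont : ContinuousOn xbar (Icc 0 1)) (hx_smooth : ContDiffOn ℝ 2 xbar (Ioo 0 1))
    (hx_zero : xbar 0 = a) (hx_one : xbar 1 = b)
    (hcurve_Ω : ∀ t ∈ Icc (0 : ℝ) 1, WassersteinConformal.movingHomothety μbar R xbar t Ωᶜ = 0) :
    (∀ K : ℝ,
      WassersteinConformal.HasConstantK (WassersteinConformal.movingHomothety μbar R xbar) K →
        (WassersteinConformal.CurveSolvesSystem Ω
            (WassersteinConformal.movingHomothety μbar R xbar) K ↔
          (∀ t ∈ Icc (0 : ℝ) 1, xbar t = (1 - t) • a + t • b) ∧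
            StrictConcaveOn ℝ (Icc 0 1) R)) ∧
    ((∃ K : ℝ,
        WassersteinConformal.HasConstantK (WassersteinConformal.movingHomothety μbar R xbar) K ∧
        WassersteinConformal.CurveSolvesSystem Ω
          (WassersteinConformal.movingHomothety μbar R xbar) K) ↔
      (∀ t ∈ Ioo (0 : ℝ) 1, deriv (deriv xbar) t = 0) ∧
        (∃ C : ℝ, ∀ t ∈ Ioo (0 : ℝ) 1,
          R t ^ (2 * d) * (d * ρ ^ 2 * deriv R t ^ 2 + (d + 4) * ‖deriv xbar t‖ ^ 2) = C) ∧
        StrictConcaveOn ℝ (Icc 0 1) R) := by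
  have h : WassersteinConformal.IsParabolicProfile A ρ μbar := ⟨hd, hρ, hμbar_prob, hμbar⟩
  have c : WassersteinConformal.IsHomothetyPath R xbar :=
    ⟨hR_cont, hR_smooth, hR_pos, hx_cont, hx_smooth⟩
  have hd4 : (d : ℝ) + 4 ≠ 0 := by positivity
  -- The conserved quantity in the statement is d + 4 times R²ᵈ V.
  have henergy : ∀ t, R t ^ (2 * d) * (d * ρ ^ 2 * deriv R t ^ 2 + (d + 4) * ‖deriv xbar t‖ ^ 2)
      = (d + 4) * (R t ^ (2 * d) * WassersteinConformal.homothetyEnergy ρ R xbar t) := fun t => by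
    rw [WassersteinConformal.homothetyEnergy]
    field_simp
  have haffine : (∀ t ∈ Icc (0 : ℝ) 1, xbar t = (1 - t) • a + t • b) ↔
      ∀ t ∈ Ioo (0 : ℝ) 1, deriv (deriv xbar) t = 0 := by
    constructor
    · intro hx t ht
      have h1 : ∀ s ∈ Ioo (0 : ℝ) 1, deriv xbar s = b - a := fun s hs => by
        have h2 : HasDerivAt (fun r : ℝ => (1 - r) • a + r • b) (b - a) s :=
          ((((hasDerivAt_id s).const_sub 1).smul_const a).add
            ((hasDerivAt_id s).smul_const b)).congr_deriv (by module)
        refine (h2.congr_of_eventuallyEq ?_).deriv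
        filter_upwards [Ioo_mem_nhds hs.1 hs.2] with r hr using hx r (Ioo_subset_Icc_self hr)
      have h3 : deriv xbar =ᶠ[𝓝 t] fun _ => b - a := by
        filter_upwards [Ioo_mem_nhds ht.1 ht.2] with s hs using h1 s hs
      rw [h3.deriv_eq, deriv_const]
    · intro hx t ht
      rw [WassersteinConformal.eq_affine_of_deriv_deriv_eq_zero hx_cont hx_smooth hx ht, hx_zero,
        hx_one]
  constructor
  · intro K hK
    rw [c.curveSolvesSystem_iff h hΩ_closed hcurve_Ω hK, haffine]
  · constructor
    · rintro ⟨K, hK, hsol⟩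
      obtain ⟨hx, hR⟩ := (c.curveSolvesSystem_iff h hΩ_closed hcurve_Ω hK).1 hsol
      exact ⟨hx, ⟨_, fun t ht => by rw [henergy, c.energy_eq_of_hasConstantK h hK ht]⟩, hR⟩
    · rintro ⟨hx, ⟨C, hC⟩, hR⟩
      obtain ⟨K, hK⟩ := c.exists_hasConstantK h hx (C := C / (d + 4))
        (fun t ht => by rw [eq_div_iff hd4, mul_comm, ← henergy, hC t ht]) hR
      exact ⟨K, hK, (c.curveSolvesSystem_iff h hΩ_closed hcurve_Ω hK).2 ⟨hx, hR⟩⟩
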